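/- All semigroups are nonempty unless stated otherwise. A \emph{pseudovariety} is a class of finite semigroups closed under homomorphic images, subsemigroups and finite direct products; $\mathsf S$ denotes the pseudovariety of all finite semigroups, and a pseudovariety is \emph{proper} if it is not $\mathsf S$. For a subsemigroup $U$ of a semigroup $S$, the \emph{dominion} $\mathrm{Dom}(U,S)$ is the set of all $d\in S$ such that any two morphisms from $S$ to a common semigroup which agree on $U$ also agree at $d$. A finite semigroup $S$ is \emph{F-saturated} if $\mathrm{Dom}(S,T)\neq T$ for every finite semigroup $T$ properly containing $S$ as a subsemigroup; a pseudovariety is F-saturated if all its members are. A pseudovariety $\mathsf V$ is \emph{F-epimorphically closed} if, whenever $S\in\mathsf V$, $T$ is a finite semigroup and $S\to T$ is an epimorphism in the category of all semigroups, then $T\in\mathsf V$. For an element $s$ of a finite semigroup, $s^\omega$ denotes its unique idempotent power and $s^{\omega+1}=s^\omega s$. Let \[ \mathsf V_1=[\![(exf)^{\omega+1}=exf]\!],\qquad \mathsf V_2=[\![exf(ef)^\omega=exf]\!],\qquad \mathsf V_3=[\![(ef)^\omega exf=exf]\!] \] be the pseudovarieties of all finite semigroups in which the indicated equality holds for all elements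 $x$ and all idempotents $e,f$. Let $Y=\{ab,a,ba,0\}$, a subsemigroup of the Brandt semigroup $B_2=\langle a,b : aba=a,\ bab=b,\ a^2=b^2=0\rangle$. \textbf{Theorem.} For every pseudovariety $\mathsf V$, exactly one of the following alternatives holds: \begin{enumerate} \item $\mathsf V$ is F-saturated and F-epimorphically closed, and $\mathsf V$ is contained in $\mathsf V_1$, in $\mathsf V_2$ or in $\mathsf V_3$; \item $\mathsf V$ is not F-saturated, and the only F-epimorphically closed pseudovariety containing $\mathsf V$ is $\mathsf S$. \end{enumerate} The second alternative holds if and only if $Y\in\mathsf V$. If $\mathsf V$ is proper, then $\mathsf V$ is F-epimorphically closed if and only if it is F-saturated. Moreover, F-saturation is decidable for pseudovarieties with decidable membership problem: there is an algorithm which, given any program that decides membership in some pseudovariety $\mathsf V$ (finite semigroups being given by their multiplication tables), halts and decides whether $\mathsf V$ is F-saturated. -/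

import Mathlib

namespace FinSemigroup

/-! ### The `ω`-power -/

/-- Positive powers in a semigroup: `ppow s n` is `s ^ (n + 1)`. -/
def ppow {S : Type} [Semigroup S] (s : S) : ℕ → S
  | 0 => s
  | n + 1 => ppow s n * s

theorem coe_ppow {S : Type} [Semigroup S] (s : S) (n : ℕ) :
    ((ppow s n : S) : WithOne S) = (s : WithOne S) ^ (n + 1) := by
  induction n with
  | zero => simp [ppow]
  | succ n ih => rw [ppow, WithOne.coe_mul, ih, ← pow_succ]

theorem map_ppow {S T : Type} [Semigroup S] [Semigroup T] (φ : S →ₙ* T) (s : S) (n : ℕ) :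
    φ (ppow s n) = ppow (φ s) n := by
  induction n with
  | zero => rfl
  | succ n ih => simp [ppow, ih]

theorem exists_idempotent_ppow {S : Type} [Semigroup S] [Finite S] (s : S) :
    ∃ e : S, IsIdempotentElem e ∧ ∃ n, ppow s n = e := by
  let _ : TopologicalSpace S := ⊥
  have : DiscreteTopology S := ⟨rfl⟩
  obtain ⟨e, ⟨n, hn⟩, he⟩ := exists_idempotent_in_compact_subsemigroup
    (fun _ : S => continuous_of_discreteTopology) (Set.range (ppow s)) ⟨s, 0, rfl⟩
    (Set.toFinite _).isCompact (by
      rintro _ ⟨m, rfl⟩ _ ⟨n, rfl⟩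
      refine ⟨m + n + 1, WithOne.coe_inj.1 ?_⟩
      rw [WithOne.coe_mul, coe_ppow, coe_ppow, coe_ppow, ← pow_add]
      congr 1
      omega)
  exact ⟨e, he, n, hn⟩

theorem idempotent_ppow_unique {S : Type} [Semigroup S] {s e f : S}
    (he : IsIdempotentElem e) (hf : IsIdempotentElem f)
    (hes : ∃ n, ppow s n = e) (hfs : ∃ n, ppow s n = f) : e = f := by
  obtain ⟨m, rfl⟩ := hes
  obtain ⟨n, rfl⟩ := hfs
  have he' : IsIdempotentElem ((ppow s m : S) : WithOne S) := by
    rw [IsIdempotentElem, ← WithOne.coe_mul, he.eq]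
  have hf' : IsIdempotentElem ((ppow s n : S) : WithOne S) := by
    rw [IsIdempotentElem, ← WithOne.coe_mul, hf.eq]
  have h1 := he'.pow_succ_eq n
  have h2 := hf'.pow_succ_eq m
  apply WithOne.coe_inj.1
  rw [← h1, ← h2, coe_ppow, coe_ppow, ← pow_mul, ← pow_mul, mul_comm]

/-- `s ^ ω`: the unique idempotent among the positive powers of an element `s` of a finite
semigroup. -/
noncomputable def omegaPow {S : Type} [Semigroup S] [Finite S] (s : S) : S :=
  (exists_idempotent_ppow s).choose

theorem omegaPow_idempotent {S : Type} [Semigroup S] [Finite S] (s : S) :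
    IsIdempotentElem (omegaPow s) :=
  (exists_idempotent_ppow s).choose_spec.1

theorem omegaPow_eq_ppow {S : Type} [Semigroup S] [Finite S] (s : S) :
    ∃ n, ppow s n = omegaPow s :=
  (exists_idempotent_ppow s).choose_spec.2

theorem map_omegaPow {S T : Type} [Semigroup S] [Finite S] [Semigroup T] [Finite T]
    (φ : S →ₙ* T) (s : S) : φ (omegaPow s) = omegaPow (φ s) := by
  refine idempotent_ppow_unique (s := φ s) ?_ (omegaPow_idempotent _) ?_ (omegaPow_eq_ppow _)
  · exact (omegaPow_idempotent s).map φ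
  · obtain ⟨n, hn⟩ := omegaPow_eq_ppow s
    exact ⟨n, by rw [← map_ppow, hn]⟩

theorem omegaPow_of_idempotent {S : Type} [Semigroup S] [Finite S] {e : S}
    (he : IsIdempotentElem e) : omegaPow e = e :=
  idempotent_ppow_unique (omegaPow_idempotent e) he (omegaPow_eq_ppow e) ⟨0, rfl⟩

/-! ### Dominions, epimorphisms and F-saturation -/

/-- The dominion of the subsemigroup `U` in the semigroup `S`. The morphisms considered are
morphisms into arbitrary (possibly infinite) semigroups. -/
def Dom {S : Type} [Semigroup S] (U : Subsemigroup S) : Set S :=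
  {d | ∀ (T : Type) [Semigroup T] (α β : S →ₙ* T), (∀ u ∈ U, α u = β u) → α d = β d}

/-- A finite semigroup `S` is F-saturated if it is not epimorphically embedded in any finite
semigroup `T` properly containing it. The containment is given by an injective
morphism `S → T`, proper when it is not onto. -/
def IsFSaturated (S : Type) [Semigroup S] [Finite S] : Prop :=
  ∀ (T : Type) [Semigroup T] [Finite T] (ι : S →ₙ* T),
    Function.Injective ι → ¬ Function.Surjective ι → Dom ι.srange ≠ Set.univ

/-! ### Pseudovarieties -/

/-- A pseudovariety of semigroups: a class of finite (nonempty) semigroups closed under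
homomorphic images, subsemigroups and finite direct products. -/
structure Pseudovariety where
  Mem : ∀ (S : Type) [Semigroup S] [Finite S] [Nonempty S], Prop
  image : ∀ (S T : Type) [Semigroup S] [Finite S] [Nonempty S]
    [Semigroup T] [Finite T] [Nonempty T] (φ : S →ₙ* T),
    Function.Surjective φ → Mem S → Mem T
  sub : ∀ (S : Type) [Semigroup S] [Finite S] [Nonempty S] (U : Subsemigroup S) [Nonempty U],
    Mem S → Mem U
  pi : ∀ (n : ℕ) (S : Fin n → Type) [∀ i, Semigroup (S i)] [∀ i, Finite (S i)]
    [∀ i, Nonempty (S i)], (∀ i, Mem (S i)) → Mem (∀ i, S i)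

namespace Pseudovariety

/-- Containment of pseudovarieties. -/
instance : LE Pseudovariety where
  le V W := ∀ (S : Type) [Semigroup S] [Finite S] [Nonempty S], V.Mem S → W.Mem S

/-- The pseudovariety of all finite semigroups. -/
def allFinite : Pseudovariety where
  Mem _ := True
  image := by intros; trivial
  sub := by intros; trivial
  pi := by intros; trivial

/-- All members are F-saturated. -/
def FSaturated (V : Pseudovariety) : Prop :=
  ∀ (S : Type) [Semigroup S] [Finite S] [Nonempty S], V.Mem S → IsFSaturated S

/-- If `S → T` is an epimorphism in the category of all semigroups, `T` is finite and `S`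
belongs to the class, then so does `T`. -/
def FEpimorphicallyClosed (V : Pseudovariety) : Prop :=
  ∀ (S T : Type) [Semigroup S] [Finite S] [Nonempty S] [Semigroup T] [Finite T] [Nonempty T]
    (φ : S →ₙ* T), CategoryTheory.Epi (Semigrp.ofHom φ) → V.Mem S → V.Mem T

/-- The pseudovariety defined by a pseudoidentity `t(e, x, f) = exf`, where `e`, `f` stand for
arbitrary idempotents, `x` for an arbitrary element, and `t` is a ternary operation on finite
semigroups that commutes with all morphisms. -/
def ofPseudoidentity (t : ∀ (S : Type) [Semigroup S] [Finite S], S → S → S → S)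
    (ht : ∀ (S T : Type) [Semigroup S] [Finite S] [Semigroup T] [Finite T] (φ : S →ₙ* T)
      (e x f : S), φ (t S e x f) = t T (φ e) (φ x) (φ f)) : Pseudovariety where
  Mem S := ∀ e x f : S, IsIdempotentElem e → IsIdempotentElem f → t S e x f = e * x * f
  image := by
    intro S T _ _ _ _ _ _ φ hφ h e x f he hf
    obtain ⟨e', rfl⟩ := hφ e
    obtain ⟨x', rfl⟩ := hφ x
    obtain ⟨f', rfl⟩ := hφ f
    rw [← omegaPow_of_idempotent he, ← omegaPow_of_idempotent hf, ← map_omegaPow,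
      ← map_omegaPow, ← ht,
      h _ _ _ (omegaPow_idempotent e') (omegaPow_idempotent f'), map_mul, map_mul]
  sub := by
    intro S _ _ _ U _ h e x f he hf
    apply Subtype.ext
    have := ht U S (MulMemClass.subtype U) e x f
    refine this.trans ?_
    exact h e x f (he.map (MulMemClass.subtype U)) (hf.map (MulMemClass.subtype U))
  pi := by
    intro n S _ _ _ h e x f he hf
    funext i
    have := ht (∀ i, S i) (S i) (Pi.evalMulHom S i) e x f
    refine this.trans ?_
    exact h i (e i) (x i) (f i) (he.map (Pi.evalMulHom S i)) (hf.map (Pi.evalMulHom S i))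

/-- `⟦(exf)^{ω+1} = exf⟧`, where `s^{ω+1} = s^ω s`. -/
noncomputable def V₁ : Pseudovariety :=
  ofPseudoidentity (fun _ _ _ e x f => omegaPow (e * x * f) * (e * x * f))
    (by intros; simp only [map_mul, map_omegaPow])

/-- `⟦exf(ef)^ω = exf⟧`. -/
noncomputable def V₂ : Pseudovariety :=
  ofPseudoidentity (fun _ _ _ e x f => e * x * f * omegaPow (e * f))
    (by intros; simp only [map_mul, map_omegaPow])

/-- `⟦(ef)^ω exf = exf⟧`. -/
noncomputable def V₃ : Pseudovariety :=
  ofPseudoidentity (fun _ _ _ e x f => omegaPow (e * f) * (e * x * f))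
    (by intros; simp only [map_mul, map_omegaPow])

end Pseudovariety

/-! ### The semigroup `Y` -/

/-- The subsemigroup `{ab, a, ba, 0}` of the five-element Brandt semigroup
`B₂ = ⟨a, b : aba = a, bab = b, a² = b² = 0⟩`. -/
inductive Y : Type
  | ab
  | a
  | ba
  | zero

namespace Y

/-- The multiplication of `Y`; all products not listed are zero. -/
def mul : Y → Y → Y
  | ab, ab => ab
  | ab, a => a
  | a, ba => a
  | ba, ba => ba
  | _, _ => zero

instance : Semigroup Y where
  mul := mul
  mul_assoc x y z := by cases x <;> cases y <;> cases z <;> rfl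

instance : Finite Y :=
  Finite.of_surjective (![ab, a, ba, zero] : Fin 4 → Y) (by
    intro y
    cases y
    exacts [⟨0, rfl⟩, ⟨1, rfl⟩, ⟨2, rfl⟩, ⟨3, rfl⟩])

instance : Nonempty Y := ⟨zero⟩

end Y

/-! ### Decidability of membership -/

/-- The multiplication table of a semigroup whose elements are listed as
`e 0, …, e (n - 1)`: the entry in row `i` and column `j` is the index of `e i * e j`. -/
def mulTable {S : Type} [Semigroup S] {n : ℕ} (e : Fin n ≃ S) : List (List ℕ) :=
  List.ofFn fun i => List.ofFn fun j => (e.symm (e i * e j) : ℕ)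

/-- The program `c` decides membership in `V`: on input (the code of) a multiplication table of
a finite semigroup, it halts with output `1` if the semigroup belongs to `V` and `0` if not. -/
def DecidesMembership (c : Nat.Partrec.Code) (V : Pseudovariety) : Prop :=
  ∀ (S : Type) [Semigroup S] [Finite S] [Nonempty S] (n : ℕ) (e : Fin n ≃ S),
    (V.Mem S → 1 ∈ c.eval (Encodable.encode (mulTable e))) ∧
    (¬ V.Mem S → 0 ∈ c.eval (Encodable.encode (mulTable e)))

end FinSemigroup

namespace FinSemigroup

/-! ### The tensor square over a submonoid and dominions -/

/-! Everything reduces to whether `Y` lies in the pseudovariety.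

If it does, so do its variants with the arrow `a` replaced by a finite family indexed by a monoid
`M`, as they embed in powers of `Y`. Such a variant dominates the full semigroup of matrix units
over `M`, because the missing unit `b` is determined by `ab`, `a`, `ba`. This refutes saturation.
Taking `M` to be `S` with an identity adjoined, it also puts an arbitrary finite `S` into every
F-epimorphically closed pseudovariety containing `Y` (`mem_of_mem_Y`).

If it does not, one of the three pseudoidentities holds (`le_of_not_mem_Y`): when idempotents `e`,
`f` and an element `s` with `es = s = sf` do not generate something mapping onto `Y`, `s` equals a
word in `e`, `s`, `f` whose value in `Y` is zero. Well-chosen generators in direct products make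
such an equality informative.

Each pseudoidentity gives saturation (`isFSaturated_of_identity`). In a finite `T` dominated by `U`,
zigzags cross the boundary of `U`. Near a `J`-maximal element outside `U` they produce idempotents
`i`, `j` and an element `s` of `U` with `s` in the `R`-class of `i` and the `L`-class of `j`. The
pseudoidentity gives `s` a right inverse inside `U`, which pulls an outside element into `U`
(`eq_top_of_dominated`).

F-saturation is therefore decided by one query: the multiplication table of `Y`. -/

/-- The elementary moves defining the tensor product `M ⊗_N M`. -/
inductive TensorRel {M : Type} [Monoid M] (N : Submonoid M) : M × M → M × M → Prop
  | move (x u y : M) (hu : u ∈ N) : TensorRel N (x * u, y) (x, u * y)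

/-- The tensor product `M ⊗_N M` of a monoid with itself over a submonoid. -/
abbrev TensorSq {M : Type} [Monoid M] (N : Submonoid M) : Type := Quot (TensorRel N)

namespace TensorSq

variable {M : Type} [Monoid M] {N : Submonoid M}

/-- Left multiplication on `M ⊗_N M`. -/
def lmul (m : M) : TensorSq N → TensorSq N :=
  Quot.map (fun p => (m * p.1, p.2)) (by
    rintro _ _ ⟨x, u, y, hu⟩
    simpa [mul_assoc] using TensorRel.move (m * x) u y hu)

/-- Right multiplication on `M ⊗_N M`. -/
def rmul (m : M) : TensorSq N → TensorSq N :=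
  Quot.map (fun p => (p.1, p.2 * m)) (by
    rintro _ _ ⟨x, u, y, hu⟩
    simpa [mul_assoc] using TensorRel.move x u (y * m) hu)

theorem lmul_mul (m n : M) : lmul (N := N) (m * n) = lmul m ∘ lmul n := by
  funext q
  induction q using Quot.ind
  simp [lmul, Quot.map, mul_assoc]

theorem rmul_mul (m n : M) : rmul (N := N) (m * n) = rmul n ∘ rmul m := by
  funext q
  induction q using Quot.ind
  simp [rmul, Quot.map, mul_assoc]

theorem lmul_comp_rmul (m n : M) : lmul (N := N) m ∘ rmul n = rmul n ∘ lmul m := by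
  funext q
  induction q using Quot.ind
  rfl

end TensorSq

/-- The split extension of `M` by the free abelian group on the bimodule `M ⊗_N M`. -/
@[ext]
structure TensorExt {M : Type} [Monoid M] (N : Submonoid M) : Type where
  base : M
  fibre : FreeAbelianGroup (TensorSq N)

namespace TensorExt

open FreeAbelianGroup

variable {M : Type} [Monoid M] {N : Submonoid M}

noncomputable instance : Semigroup (TensorExt N) where
  mul p q := ⟨p.base * q.base,
    map (TensorSq.lmul p.base) q.fibre + map (TensorSq.rmul q.base) p.fibre⟩
  mul_assoc p q r := by
    refine TensorExt.ext (mul_assoc _ _ _) ?_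
    change map (TensorSq.lmul (p.base * q.base)) r.fibre +
        map (TensorSq.rmul r.base) (map (TensorSq.lmul p.base) q.fibre +
          map (TensorSq.rmul q.base) p.fibre) =
      map (TensorSq.lmul p.base) (map (TensorSq.lmul q.base) r.fibre +
          map (TensorSq.rmul r.base) q.fibre) +
        map (TensorSq.rmul (q.base * r.base)) p.fibre
    rw [map_add, map_add, TensorSq.lmul_mul, TensorSq.rmul_mul, map_comp_apply, map_comp_apply,
      ← map_comp_apply (f := TensorSq.rmul r.base), TensorSq.lmul_comp_rmul, map_comp_apply,
      add_assoc]

theorem mul_fibre (p q : TensorExt N) : (p * q).fibre =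
    map (TensorSq.lmul p.base) q.fibre + map (TensorSq.rmul q.base) p.fibre := rfl

/-- The trivial section. -/
noncomputable def section₀ (N : Submonoid M) : M →ₙ* TensorExt N where
  toFun m := ⟨m, 0⟩
  map_mul' m n := TensorExt.ext rfl (by simp [mul_fibre])

/-- The section given by the inner derivation `m ↦ m ⊗ 1 - 1 ⊗ m`. -/
noncomputable def section₁ (N : Submonoid M) : M →ₙ* TensorExt N where
  toFun m := ⟨m, of (Quot.mk _ (m, 1)) - of (Quot.mk _ (1, m))⟩
  map_mul' m n := TensorExt.ext rfl (by
    simp [mul_fibre, map_of_apply, TensorSq.lmul, TensorSq.rmul, Quot.map])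

theorem section_eq_of_mem {u : M} (hu : u ∈ N) : section₀ N u = section₁ N u := by
  refine TensorExt.ext rfl ?_
  have h : (Quot.mk _ (u, 1) : TensorSq N) = Quot.mk _ (1, u) := by
    simpa using Quot.sound (TensorRel.move 1 u 1 hu)
  simp [section₀, section₁, h]

/-- The sections differ at `d` by `d ⊗ 1 - 1 ⊗ d`. Since the fibre is free on the tensor square,
this vanishes only if the two basis elements coincide. The sections agree on `N`, so this applies to
every dominated element. -/
theorem eqvGen_of_section_eq {d : M} (h : section₀ N d = section₁ N d) :
    Relation.EqvGen (TensorRel N) (d, 1) (1, d) := by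
  have h' := congrArg TensorExt.fibre h
  simp only [section₀, section₁, MulHom.coe_mk] at h'
  exact Quot.eqvGen_exact (of_injective (sub_eq_zero.1 h'.symm))

end TensorExt

/-- The submonoid `U ∪ {1}` of `WithOne T`. -/
def adjoinOne {T : Type} [Semigroup T] (U : Subsemigroup T) : Submonoid (WithOne T) where
  carrier := {x | x = 1 ∨ ∃ u ∈ U, (u : WithOne T) = x}
  one_mem' := Or.inl rfl
  mul_mem' := by
    rintro _ _ (rfl | ⟨u, hu, rfl⟩) (rfl | ⟨v, hv, rfl⟩)
    · exact Or.inl (one_mul 1)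
    · exact Or.inr ⟨v, hv, (one_mul _).symm⟩
    · exact Or.inr ⟨u, hu, (mul_one _).symm⟩
    · exact Or.inr ⟨u * v, U.mul_mem hu hv, rfl⟩

theorem mem_adjoinOne {T : Type} [Semigroup T] {U : Subsemigroup T} {x : WithOne T} :
    x ∈ adjoinOne U ↔ x = 1 ∨ ∃ u ∈ U, (u : WithOne T) = x := Iff.rfl

theorem coe_mem_adjoinOne {T : Type} [Semigroup T] {U : Subsemigroup T} {t : T} :
    (t : WithOne T) ∈ adjoinOne U ↔ t ∈ U := by
  rw [mem_adjoinOne]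
  constructor
  · rintro (h | ⟨u, hu, h⟩)
    · exact absurd h WithOne.coe_ne_one
    · exact WithOne.coe_inj.1 h ▸ hu
  · exact fun h => Or.inr ⟨t, h, rfl⟩

theorem eqvGen_of_mem_Dom {T : Type} [Semigroup T] {U : Subsemigroup T} {d : T}
    (hd : d ∈ Dom U) :
    Relation.EqvGen (TensorRel (adjoinOne U)) ((d : WithOne T), 1) (1, (d : WithOne T)) :=
  TensorExt.eqvGen_of_section_eq
    (hd _ ((TensorExt.section₀ (adjoinOne U)).comp WithOne.coeMulHom)
      ((TensorExt.section₁ (adjoinOne U)).comp WithOne.coeMulHom)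
      fun _ hu => TensorExt.section_eq_of_mem (coe_mem_adjoinOne.2 hu))

/-! ### Finite monoids -/

section FiniteMonoid

variable {M : Type} [Monoid M]

theorem ppow_eq_pow (s : M) (n : ℕ) : ppow s n = s ^ (n + 1) := by
  induction n with
  | zero => simp [ppow]
  | succ n ih => rw [ppow, ih, ← pow_succ]

theorem exists_pow_idempotent [Finite M] (s : M) : ∃ n, IsIdempotentElem (s ^ (n + 1)) := by
  obtain ⟨e, he, n, rfl⟩ := exists_idempotent_ppow s
  exact ⟨n, ppow_eq_pow s n ▸ he⟩

theorem eq_pow_mul_mul_pow {x u v : M} (h : x = u * x * v) (n : ℕ) : x = u ^ n * x * v ^ n := by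
  induction n with
  | zero => simp
  | succ n ih =>
    calc x = u * (u ^ n * x * v ^ n) * v := by rw [← ih, ← h]
      _ = _ := by rw [pow_succ' u, pow_succ v]; simp only [mul_assoc]

/-- Iterating gives `x = u ^ k * x * v ^ k` for all `k`. When `u ^ k` is idempotent it fixes `x` and
can be dropped. -/
theorem exists_eq_mul_pow [Finite M] {x u v : M} (h : x = u * x * v) :
    ∃ n, x = x * v ^ (n + 1) := by
  obtain ⟨n, hn⟩ := exists_pow_idempotent u
  have hx := eq_pow_mul_mul_pow h (n + 1)
  have hu : u ^ (n + 1) * x = x := by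
    conv_lhs => rw [hx, ← mul_assoc, ← mul_assoc, hn.eq]
    exact hx.symm
  exact ⟨n, by conv_lhs => rw [hx, hu]⟩

theorem exists_eq_pow_mul [Finite M] {x u v : M} (h : x = u * x * v) :
    ∃ n, x = u ^ (n + 1) * x := by
  obtain ⟨n, hn⟩ := exists_pow_idempotent v
  have hx := eq_pow_mul_mul_pow h (n + 1)
  have hv : x * v ^ (n + 1) = x := by
    conv_lhs => rw [hx, mul_assoc, hn.eq]
    exact hx.symm
  exact ⟨n, by conv_lhs => rw [hx, mul_assoc, hv]⟩

/-- The `J`-preorder of a monoid. -/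
def JLe (x y : M) : Prop := ∃ p q, x = p * y * q

theorem JLe.refl (x : M) : JLe x x := ⟨1, 1, by simp⟩

theorem JLe.trans {x y z : M} : JLe x y → JLe y z → JLe x z := by
  rintro ⟨p, q, rfl⟩ ⟨p', q', rfl⟩
  exact ⟨p * p', q' * q, by simp only [mul_assoc]⟩

theorem JLe.mul_right (x y : M) : JLe (x * y) x := ⟨1, y, by simp⟩

theorem JLe.mul_left (x y : M) : JLe (x * y) y := ⟨x, 1, by simp⟩

/-- Stability of finite monoids: a right multiple in the same `J`-class is in the same `R`-class. -/
theorem JLe.exists_mul_right [Finite M] {x v : M} (h : JLe x (x * v)) : ∃ w, x = x * v * w := by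
  obtain ⟨p, q, h⟩ := h
  obtain ⟨n, hn⟩ := exists_eq_mul_pow (x := x) (u := p) (v := v * q)
    (by simpa only [mul_assoc] using h)
  exact ⟨q * (v * q) ^ n, hn.trans (by rw [pow_succ']; simp only [mul_assoc])⟩

theorem JLe.exists_mul_left [Finite M] {x v : M} (h : JLe x (v * x)) : ∃ w, x = w * (v * x) := by
  obtain ⟨p, q, h⟩ := h
  obtain ⟨n, hn⟩ := exists_eq_pow_mul (x := x) (u := p * v) (v := q)
    (by simpa only [mul_assoc] using h)
  exact ⟨(p * v) ^ n * p, hn.trans (by rw [pow_succ]; simp only [mul_assoc])⟩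

/-- `d` lies outside `N`, in a `J`-class maximal with this property. -/
def MaximalOutside (N : Submonoid M) (d : M) : Prop :=
  d ∉ N ∧ ∀ y, y ∉ N → JLe d y → JLe y d

theorem exists_maximalOutside [Finite M] {N : Submonoid M} {x : M} (hx : x ∉ N) :
    ∃ d, MaximalOutside N d := by
  -- A largest principal down-set cannot be properly contained in another one.
  obtain ⟨d, hd, hmax⟩ := Set.exists_max_image {y | y ∉ N} (fun y => {z | JLe z y}.ncard)
    (Set.toFinite _) ⟨x, hx⟩
  refine ⟨d, hd, fun y hy hdy => ?_⟩
  have hsub : {z | JLe z d} ⊆ {z | JLe z y} := fun z hz => JLe.trans hz hdy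
  have := Set.eq_of_subset_of_ncard_le hsub (hmax y hy) (Set.toFinite _)
  have hyy : y ∈ {z | JLe z y} := JLe.refl y
  rwa [← this] at hyy

theorem MaximalOutside.of_JLe {N : Submonoid M} {d y : M} (h : MaximalOutside N d) (hy : y ∉ N)
    (hdy : JLe d y) : MaximalOutside N y :=
  ⟨hy, fun z hz hyz => (h.2 z hz (hdy.trans hyz)).trans hdy⟩

/-! ### Zigzags -/

/-- Along the zigzag the product of the coordinates stays `d`, while the first coordinate goes from
`d`, outside `N`, to `1`, inside. Some move between `x * u` and `x` must cross, and `x ∈ N` would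
force `x * u ∈ N`. -/
theorem exists_left_transition {N : Submonoid M} {d : M} (hd : d ∉ N)
    (h : Relation.EqvGen (TensorRel N) (d, 1) (1, d)) :
    ∃ x u y, u ∈ N ∧ x ∉ N ∧ x * u ∈ N ∧ d = x * u * y := by
  by_contra! hno
  have key : ∀ a b, Relation.EqvGen (TensorRel N) a b →
      a.1 * a.2 = b.1 * b.2 ∧ (a.1 * a.2 = d → (a.1 ∈ N ↔ b.1 ∈ N)) := by
    intro a b hab
    induction hab with
    | rel a b hab =>
      obtain ⟨x, u, y, hu⟩ := hab
      refine ⟨mul_assoc _ _ _, fun hxy => ⟨fun hxu => ?_, fun hx => N.mul_mem hx hu⟩⟩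
      by_contra hx
      exact hno x u y hu hx hxu hxy.symm
    | refl => exact ⟨rfl, fun _ => Iff.rfl⟩
    | symm a b _ ih => exact ⟨ih.1.symm, fun hb => (ih.2 (ih.1.trans hb)).symm⟩
    | trans a b c _ _ ih₁ ih₂ =>
      exact ⟨ih₁.1.trans ih₂.1, fun ha => (ih₁.2 ha).trans (ih₂.2 (ih₁.1.symm.trans ha))⟩
  exact hd (((key _ _ h).2 (mul_one d)).2 N.one_mem)

theorem exists_right_transition {N : Submonoid M} {d : M} (hd : d ∉ N)
    (h : Relation.EqvGen (TensorRel N) (d, 1) (1, d)) :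
    ∃ x u y, u ∈ N ∧ y ∉ N ∧ u * y ∈ N ∧ d = x * (u * y) := by
  by_contra! hno
  have key : ∀ a b, Relation.EqvGen (TensorRel N) a b →
      a.1 * a.2 = b.1 * b.2 ∧ (a.1 * a.2 = d → (a.2 ∈ N ↔ b.2 ∈ N)) := by
    intro a b hab
    induction hab with
    | rel a b hab =>
      obtain ⟨x, u, y, hu⟩ := hab
      refine ⟨mul_assoc _ _ _, fun hxy => ⟨fun hy => N.mul_mem hu hy, fun huy => ?_⟩⟩
      by_contra hy
      exact hno x u y hu hy huy (hxy.symm.trans (mul_assoc _ _ _))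
    | refl => exact ⟨rfl, fun _ => Iff.rfl⟩
    | symm a b _ ih => exact ⟨ih.1.symm, fun hb => (ih.2 (ih.1.trans hb)).symm⟩
    | trans a b c _ _ ih₁ ih₂ =>
      exact ⟨ih₁.1.trans ih₂.1, fun ha => (ih₁.2 ha).trans (ih₂.2 (ih₁.1.symm.trans ha))⟩
  exact hd (((key _ _ h).2 (mul_one d)).1 N.one_mem)

theorem exists_loop {α : Type} [Finite α] (r : α → α → Prop)
    (htrans : ∀ a b c, r a b → r b c → r a c) (hserial : ∀ a, ∃ b, r a b) (a : α) :
    ∃ b, r a b ∧ r b b := by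
  choose f hf using hserial
  have : IsTrans α r := ⟨htrans⟩
  have hr : ∀ m n, m < n → r (f^[m] a) (f^[n] a) := fun m n hmn =>
    Nat.rel_of_forall_rel_succ_of_lt r (f := fun k => f^[k] a)
      (fun k => by simpa only [Function.iterate_succ_apply'] using hf _) hmn
  -- The shift by one guarantees that the repeated vertex is reached from `a` in at least one step.
  obtain ⟨m, n, hmn, h⟩ := Finite.exists_ne_map_eq_of_infinite fun k : ℕ => f^[k + 1] a
  wlog hlt : m < n generalizing m n
  · exact this n m hmn.symm h.symm (by omega)
  refine ⟨f^[m + 1] a, hr 0 (m + 1) (by omega), ?_⟩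
  have := hr (m + 1) (n + 1) (by omega)
  rwa [← h] at this

/-- A transition writes `d` as an element of `N` times another maximal outside element, all in one
`J`-class. Repeating this in a finite set runs into a loop `z = p * z` with `p ∈ N`, and `i` is an
idempotent power of `p`. -/
theorem MaximalOutside.exists_left_factor [Finite M] {N : Submonoid M} {d : M}
    (hN : ∀ d, Relation.EqvGen (TensorRel N) (d, 1) (1, d)) (hd : MaximalOutside N d) :
    ∃ c i z, c ∈ N ∧ i ∈ N ∧ IsIdempotentElem i ∧ z ∉ N ∧ d = c * i * z ∧ i * z = z ∧
      JLe i d := by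
  let r : {z // MaximalOutside N z} → {z // MaximalOutside N z} → Prop :=
    fun a b => ∃ c ∈ N, a.1 = c * b.1 ∧ JLe c a.1 ∧ JLe b.1 a.1
  obtain ⟨z, ⟨c, hc, hcz, hcd, hzd⟩, p, hp, hpz, hpJ, -⟩ := exists_loop r
    (by
      rintro a b c ⟨p, hp, hab, hpa, hba⟩ ⟨q, hq, hbc, hqb, hcb⟩
      refine ⟨p * q, N.mul_mem hp hq, by rw [hab, hbc, mul_assoc],
        (JLe.mul_right p q).trans hpa, hcb.trans hba⟩)
    (by
      rintro ⟨a, ha⟩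
      obtain ⟨x, u, y, -, hx, hxu, hay⟩ := exists_left_transition ha.1 (hN a)
      have hy : y ∉ N := fun hy => ha.1 (hay ▸ N.mul_mem hxu hy)
      have hJy : JLe a y := hay ▸ JLe.mul_left (x * u) y
      have hJx : JLe a x := hay ▸ (mul_assoc x u y).symm ▸ JLe.mul_right x (u * y)
      exact ⟨⟨y, ha.of_JLe hy hJy⟩, x * u, hxu, hay,
        (JLe.mul_right x u).trans (ha.2 x hx hJx), ha.2 y hy hJy⟩)
    ⟨d, hd⟩
  obtain ⟨n, hn⟩ := exists_pow_idempotent p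
  have hfix : ∀ k, p ^ k * z.1 = z.1 := by
    intro k
    induction k with
    | zero => simp
    | succ k ih => rw [pow_succ, mul_assoc, ← hpz, ih]
  refine ⟨c, p ^ (n + 1), z.1, hc, N.pow_mem hp _, hn, z.2.1, ?_, hfix _, ?_⟩
  · rw [mul_assoc, hfix]; exact hcz
  · rw [pow_succ]
    exact (JLe.mul_left _ _).trans (hpJ.trans hzd)

theorem MaximalOutside.exists_right_factor [Finite M] {N : Submonoid M} {d : M}
    (hN : ∀ d, Relation.EqvGen (TensorRel N) (d, 1) (1, d)) (hd : MaximalOutside N d) :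
    ∃ c i z, c ∈ N ∧ i ∈ N ∧ IsIdempotentElem i ∧ z ∉ N ∧ d = z * (i * c) ∧ z * i = z ∧
      JLe i d := by
  let r : {z // MaximalOutside N z} → {z // MaximalOutside N z} → Prop :=
    fun a b => ∃ c ∈ N, a.1 = b.1 * c ∧ JLe c a.1 ∧ JLe b.1 a.1
  obtain ⟨z, ⟨c, hc, hcz, hcd, hzd⟩, p, hp, hpz, hpJ, -⟩ := exists_loop r
    (by
      rintro a b c ⟨p, hp, hab, hpa, hba⟩ ⟨q, hq, hbc, hqb, hcb⟩
      refine ⟨q * p, N.mul_mem hq hp, by rw [hab, hbc, mul_assoc],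
        (JLe.mul_left q p).trans hpa, hcb.trans hba⟩)
    (by
      rintro ⟨a, ha⟩
      obtain ⟨x, u, y, -, hy, huy, hax⟩ := exists_right_transition ha.1 (hN a)
      have hx : x ∉ N := fun hx => ha.1 (hax ▸ N.mul_mem hx huy)
      have hJx : JLe a x := hax ▸ JLe.mul_right x (u * y)
      have hJy : JLe a y := hax ▸ (mul_assoc x u y) ▸ JLe.mul_left (x * u) y
      exact ⟨⟨x, ha.of_JLe hx hJx⟩, u * y, huy, hax,
        (JLe.mul_left u y).trans (ha.2 y hy hJy), ha.2 x hx hJx⟩)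
    ⟨d, hd⟩
  obtain ⟨n, hn⟩ := exists_pow_idempotent p
  have hfix : ∀ k, z.1 * p ^ k = z.1 := by
    intro k
    induction k with
    | zero => simp
    | succ k ih => rw [pow_succ', ← mul_assoc, ← hpz, ih]
  refine ⟨c, p ^ (n + 1), z.1, hc, N.pow_mem hp _, hn, z.2.1, ?_, hfix _, ?_⟩
  · rw [← mul_assoc, hfix]; exact hcz
  · rw [pow_succ]
    exact (JLe.mul_left _ _).trans (hpJ.trans hzd)

/-- If every element of `M` is dominated by `N`, and elements of `N` in the `R`-class of one
idempotent of `N` and the `L`-class of another are right invertible in `N`, then `N` is `M`. -/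
theorem eq_top_of_dominated [Finite M] {N : Submonoid M}
    (hN : ∀ d, Relation.EqvGen (TensorRel N) (d, 1) (1, d))
    (hinv : ∀ i ∈ N, ∀ j ∈ N, ∀ s ∈ N, IsIdempotentElem i → IsIdempotentElem j →
      (∃ x, x ∉ N ∧ JLe i x) → (∃ x, x ∉ N ∧ JLe j x) →
      i * s * j = s → (∃ y, s * y = i) → (∃ m, m * s = j) → ∃ w ∈ N, s * w = i) :
    N = ⊤ := by
  by_contra hne
  obtain ⟨x₀, hx₀⟩ : ∃ x, x ∉ N := by
    by_contra! h
    exact hne (eq_top_iff.2 fun x _ => h x)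
  obtain ⟨d, hd⟩ := exists_maximalOutside hx₀
  obtain ⟨x, u, y₀, hu, hx, hxu, hdx⟩ := exists_left_transition hd.1 (hN d)
  have hdxu : JLe d (x * u) := hdx ▸ JLe.mul_right (x * u) y₀
  have hdJx : JLe d x := hdxu.trans (JLe.mul_right x u)
  have hxd : JLe x d := hd.2 x hx hdJx
  obtain ⟨c, i, a, hc, hi, hii, ha, hxa, hai, hix⟩ :=
    (hd.of_JLe hx hdJx).exists_right_factor hN
  have hxJa : JLe x a := hxa ▸ JLe.mul_right a (i * c)
  have ham : MaximalOutside N a := (hd.of_JLe hx hdJx).of_JLe ha hxJa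
  have hax : JLe a x := (hd.of_JLe hx hdJx).2 a ha hxJa
  -- Here `a * (i * c * u) = x * u` lies in `N` and in the `J`-class of `a`, so stability leads back
  -- to `a`.
  obtain ⟨y, hy⟩ : ∃ y, a = a * (i * c * u) * y :=
    JLe.exists_mul_right (by
      rw [← mul_assoc, ← hxa]
      exact hax.trans (hxd.trans hdxu))
  have hau : a * (i * c * u) ∈ N := by rwa [← mul_assoc, ← hxa]
  have hyN : y ∉ N := fun h => ha (hy ▸ N.mul_mem hau h)
  have haJy : JLe a y := by
    conv_lhs => rw [hy]
    exact JLe.mul_left _ _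
  have hym : MaximalOutside N y := ham.of_JLe hyN haJy
  have hya : JLe y a := ham.2 y hyN haJy
  obtain ⟨c', j, z, hc', hj, hjj, hz, hyz, hjz, hjy⟩ := hym.exists_left_factor hN
  -- All factors lie in `N`. The rest of the proof places `s` in the `R`-class of `i` and the
  -- `L`-class of `j`; a right inverse `w ∈ N` then gives `a = a * i = (a * s) * w ∈ N`.
  set s := i * c * u * (c' * j) with hs
  have hsN : s ∈ N :=
    N.mul_mem (N.mul_mem (N.mul_mem hi hc) hu) (N.mul_mem hc' hj)
  have hasz : a * s * z = a := by
    conv_rhs => rw [hy, hyz]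
    simp only [hs, mul_assoc]
  have his : i * s = s := by simp only [hs, ← mul_assoc, hii.eq]
  have hsj : s * j = s := by simp only [hs, mul_assoc, hjj.eq]
  have haN : a * s ∈ N := by
    rw [hs, ← mul_assoc]
    exact N.mul_mem hau (N.mul_mem hc' hj)
  obtain ⟨k, hk⟩ : ∃ k, i = k * (a * i) :=
    JLe.exists_mul_left (by rw [hai]; exact hix.trans hxJa)
  rw [hai] at hk
  have hsz : s * z = i := by
    calc s * z = k * (a * s * z) := by rw [← mul_assoc, ← mul_assoc, ← hk, his]
      _ = i := by rw [hasz, ← hk]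
  obtain ⟨m, hm⟩ : ∃ m, j = m * (s * j) := by
    refine JLe.exists_mul_left ?_
    rw [hsj]
    refine (hjy.trans hya).trans ?_
    conv_lhs => rw [← hasz]
    exact (JLe.mul_right _ _).trans (JLe.mul_left _ _)
  rw [hsj] at hm
  obtain ⟨w, hw, hsw⟩ := hinv i hi j hj s hsN hii hjj ⟨x, hx, hix⟩ ⟨y, hyN, hjy⟩
    (by rw [his, hsj]) ⟨z, hsz⟩ ⟨m, hm.symm⟩
  apply ha
  rw [← hai, ← hsw, ← mul_assoc]
  exact N.mul_mem haN hw

/-! ### Right inverses among the powers of an element -/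

theorem pow_mul_eq_of_pow_mul_self_eq {s i y : M} (hsy : s * y = i) {n : ℕ}
    (h : s ^ (n + 1) * s = s) : s ^ (n + 1) * i = i := by
  rw [← hsy, ← mul_assoc, h]

/-- Since `s * (k * y * k) = k` and `s * k = s`, every power of `s` has a right inverse with respect
to `k`. An idempotent power of `s` therefore fixes `k` on the left, hence also `i = k * i`. -/
theorem exists_pow_mul_eq_of_right_inverse [Finite M] {s i k y : M} (hik : i * k = k)
    (hki : k * i = i) (hsk : s * k = s) (hsy : s * y = i) :
    ∃ n, s ^ (n + 1) * i = i := by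
  have hinv : ∀ n, s ^ (n + 1) * (k * y * k) ^ (n + 1) = k := by
    intro n
    have hstep : s * (k * y * k) = k := by
      rw [← mul_assoc, ← mul_assoc, hsk, hsy, hik]
    induction n with
    | zero => simpa using hstep
    | succ n ih =>
      rw [pow_succ, pow_succ' (k * y * k)]
      calc s ^ (n + 1) * s * (k * y * k * (k * y * k) ^ (n + 1))
          = s ^ (n + 1) * (s * (k * y * k)) * (k * y * k) ^ (n + 1) := by simp only [mul_assoc]
        _ = s ^ n * (s * k) * (k * y * k) ^ (n + 1) := by
          rw [hstep, pow_succ, mul_assoc (s ^ n)]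
        _ = k := by rw [hsk, ← pow_succ, ih]
  obtain ⟨n, hn⟩ := exists_pow_idempotent s
  refine ⟨n, ?_⟩
  have h1 : s ^ (n + 1) * k = k := by
    conv_lhs => rw [← hinv n, ← mul_assoc, hn.eq]
    exact hinv n
  rw [← hki, ← mul_assoc, h1]

/-- All of `i`, `j`, `s` are `J`-equivalent. Either alternative in `h` brings the idempotent `k = (i
* j) ^ (n + 1)` into their `J`-class, and stability makes it `R`-equivalent to `i` and
`L`-equivalent to `j`. -/
theorem exists_pow_mul_eq_of_omega [Finite M] {i j s y m : M} (hi : IsIdempotentElem i)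
    (hj : IsIdempotentElem j) (hsij : i * s * j = s) (hsy : s * y = i) (hms : m * s = j) {n : ℕ}
    (h : s * (i * j) ^ (n + 1) = s ∨ (i * j) ^ (n + 1) * s = s)
    (hk : IsIdempotentElem ((i * j) ^ (n + 1))) :
    ∃ n, s ^ (n + 1) * i = i := by
  set k := (i * j) ^ (n + 1) with hkdef
  have hik : i * k = k := by rw [hkdef, pow_succ']; simp only [← mul_assoc, hi.eq]
  have hkj : k * j = k := by rw [hkdef, pow_succ]; simp only [mul_assoc, hj.eq]
  have his : i * s = s := by rw [← hsij, ← mul_assoc, ← mul_assoc, hi.eq]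
  have hsj : s * j = s := by rw [← hsij, mul_assoc, hj.eq]
  have hiJj : JLe i j := ⟨s, y, by rw [hsj, hsy]⟩
  have hjJi : JLe j i := ⟨m, s, by rw [mul_assoc, his, hms]⟩
  have hboth : k * i = i ∧ j * k = j := by
    rcases h with h | h
    · have hjk : j * k = j := by rw [← hms, mul_assoc, h]
      refine ⟨?_, hjk⟩
      obtain ⟨w, hw⟩ : ∃ w, i = i * k * w :=
        JLe.exists_mul_right (by
          rw [hik]
          exact hiJj.trans ⟨j, 1, by rw [hjk, mul_one]⟩)
      rw [hik] at hw
      conv_lhs => rw [hw, ← mul_assoc, hk.eq]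
      exact hw.symm
    · have hki : k * i = i := by rw [← hsy, ← mul_assoc, h]
      refine ⟨hki, ?_⟩
      obtain ⟨w, hw⟩ : ∃ w, j = w * (k * j) :=
        JLe.exists_mul_left (by
          rw [hkj]
          exact hjJi.trans ⟨1, i, by rw [one_mul, hki]⟩)
      rw [hkj] at hw
      conv_lhs => rw [hw, mul_assoc, hk.eq]
      exact hw.symm
  exact exists_pow_mul_eq_of_right_inverse hik hboth.1 (by rw [← hsj, mul_assoc, hboth.2]) hsy

end FiniteMonoid

/-! ### F-saturation from the pseudoidentities -/

theorem map_ppow_withOne {S T : Type} [Semigroup S] [Semigroup T] (φ : S →ₙ* T) (s : S) (n : ℕ) :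
    ((φ (ppow s n) : T) : WithOne T) = ((φ s : T) : WithOne T) ^ (n + 1) := by
  rw [map_ppow, coe_ppow]

/-- The adjoined identity is not a product involving elements of `T`. Hence the idempotents that
matter come from `T` itself. -/
theorem ne_one_of_JLe {T : Type} [Semigroup T] {U : Subsemigroup T} {i : WithOne T}
    (h : ∃ x, x ∉ adjoinOne U ∧ JLe i x) : i ≠ 1 := by
  rintro rfl
  obtain ⟨x, hx, p, q, h⟩ := h
  induction x with
  | one => exact hx (one_mem _)
  | coe x =>
    induction p with
    | one =>
      induction q with
      | one => simp at h
      | coe q => rw [one_mul, ← WithOne.coe_mul] at h; exact WithOne.one_ne_coe h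
    | coe p =>
      rw [← WithOne.coe_mul] at h
      induction q with
      | one => rw [mul_one] at h; exact WithOne.one_ne_coe h
      | coe q => rw [← WithOne.coe_mul] at h; exact WithOne.one_ne_coe h

theorem isFSaturated_of_identity (S : Type) [Semigroup S] [Finite S]
    (hS : ∀ e x f : S, IsIdempotentElem e → IsIdempotentElem f →
      omegaPow (e * x * f) * (e * x * f) = e * x * f ∨
      e * x * f * omegaPow (e * f) = e * x * f ∨
      omegaPow (e * f) * (e * x * f) = e * x * f) : IsFSaturated S := by
  intro T _ _ φ hφ hsurj hDom
  have : Finite (WithOne T) := inferInstanceAs (Finite (Option T))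
  have hN : ∀ d, Relation.EqvGen (TensorRel (adjoinOne φ.srange)) (d, 1) (1, d) := by
    intro d
    induction d with
    | one => exact Relation.EqvGen.refl _
    | coe d => exact eqvGen_of_mem_Dom (hDom ▸ Set.mem_univ d)
  have htop := eq_top_of_dominated hN (by
    rintro i hi j hj s hs hii hjj hi' hj' hsij ⟨y, hy⟩ ⟨m, hm⟩
    obtain hi | ⟨_, ⟨e, rfl⟩, rfl⟩ := mem_adjoinOne.1 hi
    · exact absurd hi (ne_one_of_JLe hi')
    obtain hj | ⟨_, ⟨f, rfl⟩, rfl⟩ := mem_adjoinOne.1 hj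
    · exact absurd hj (ne_one_of_JLe hj')
    have he : IsIdempotentElem e :=
      hφ (by rw [map_mul]; exact WithOne.coe_inj.1 hii.eq)
    have hf : IsIdempotentElem f :=
      hφ (by rw [map_mul]; exact WithOne.coe_inj.1 hjj.eq)
    obtain ⟨x, rfl⟩ : ∃ x : S, ((φ (e * x * f) : T) : WithOne T) = s := by
      obtain rfl | ⟨_, ⟨x, rfl⟩, rfl⟩ := mem_adjoinOne.1 hs
      · exact ⟨e, by rw [he.eq, ← hsij, mul_one, map_mul, WithOne.coe_mul]⟩
      · exact ⟨x, by rw [← hsij]; simp only [map_mul, WithOne.coe_mul, mul_assoc]⟩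
    -- The right inverse is `s ^ n * i`, visibly in the submonoid.
    suffices h : ∃ n, ((φ (e * x * f) : T) : WithOne T) ^ (n + 1) * (φ e : T) = (φ e : T) by
      obtain ⟨n, hn⟩ := h
      exact ⟨_, mul_mem (pow_mem hs n) hi, by rw [← mul_assoc, ← pow_succ', hn]⟩
    have hlift : ∀ a b : S, a = b → ((φ a : T) : WithOne T) = (φ b : T) := by
      rintro a _ rfl; rfl
    rcases hS e x f he hf with h | h
    · obtain ⟨n, hn⟩ := omegaPow_eq_ppow (e * x * f)
      refine ⟨n, pow_mul_eq_of_pow_mul_self_eq hy ?_⟩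
      have := hlift _ _ h
      rwa [map_mul φ (omegaPow _), WithOne.coe_mul, ← hn, map_ppow_withOne] at this
    · obtain ⟨n, hn⟩ := omegaPow_eq_ppow (e * f)
      have hpow : ((φ (omegaPow (e * f)) : T) : WithOne T) =
          ((φ e : T) * (φ f : T) : WithOne T) ^ (n + 1) := by
        rw [← hn, map_ppow_withOne, map_mul, WithOne.coe_mul]
      refine exists_pow_mul_eq_of_omega hii hjj hsij hy hm (n := n) ?_ ?_
      · rw [← hpow, ← WithOne.coe_mul, ← WithOne.coe_mul, ← map_mul φ _ (omegaPow _),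
          ← map_mul φ (omegaPow _)]
        exact h.imp (hlift _ _) (hlift _ _)
      · rw [← hpow, IsIdempotentElem, ← WithOne.coe_mul, ← map_mul,
          (omegaPow_idempotent (e * f)).eq])
  refine hsurj fun t => ?_
  have ht : (t : WithOne T) ∈ adjoinOne φ.srange := htop ▸ Submonoid.mem_top _
  exact coe_mem_adjoinOne.1 ht

/-! ### Epimorphisms -/

theorem Dom_srange_eq_univ_iff_epi {S T : Type} [Semigroup S] [Semigroup T] (φ : S →ₙ* T) :
    Dom φ.srange = Set.univ ↔ CategoryTheory.Epi (Semigrp.ofHom φ) := by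
  constructor
  · intro h
    refine ⟨fun {Z} g k hgk => Semigrp.hom_ext (MulHom.ext fun t => ?_)⟩
    refine (h ▸ Set.mem_univ t : t ∈ Dom φ.srange) Z g.hom k.hom ?_
    rintro _ ⟨s, rfl⟩
    exact congrArg (fun m => m.hom s) hgk
  · intro h
    refine Set.eq_univ_of_forall fun t Z _ α β hαβ => ?_
    have : Semigrp.ofHom α = Semigrp.ofHom β := by
      rw [← CategoryTheory.cancel_epi (Semigrp.ofHom φ)]
      refine Semigrp.hom_ext (MulHom.ext fun s => ?_)
      exact hαβ _ ⟨s, rfl⟩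
    exact congrArg (fun m => m.hom t) this

namespace Pseudovariety

theorem fSaturated_of_le {V : Pseudovariety} (h : V ≤ V₁ ∨ V ≤ V₂ ∨ V ≤ V₃) :
    V.FSaturated := by
  intro S _ _ _ hS
  refine isFSaturated_of_identity S fun e x f he hf => ?_
  rcases h with h | h | h
  · exact Or.inl (h S hS e x f he hf)
  · exact Or.inr (Or.inl (h S hS e x f he hf))
  · exact Or.inr (Or.inr (h S hS e x f he hf))

/-- The image of an epimorphism dominates its codomain; being saturated, it is the whole codomain.
-/
theorem FSaturated.fEpimorphicallyClosed {V : Pseudovariety} (h : V.FSaturated) :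
    V.FEpimorphicallyClosed := by
  intro S T _ _ _ _ _ _ φ hφ hS
  have : Nonempty φ.srange := ⟨⟨_, Classical.arbitrary S, rfl⟩⟩
  have hmem : V.Mem φ.srange := V.image S _ φ.srangeRestrict φ.srangeRestrict_surjective hS
  refine V.image S T φ ?_ hS
  by_contra hsurj
  refine h φ.srange hmem T (MulMemClass.subtype φ.srange) Subtype.val_injective ?_ ?_
  · refine fun hs => hsurj fun t => ?_
    obtain ⟨⟨_, s, rfl⟩, rfl⟩ := hs t
    exact ⟨s, rfl⟩
  · rw [← Dom_srange_eq_univ_iff_epi] at hφ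
    rw [← hφ]
    congr 1
    ext t
    simp

theorem mem_of_injective (V : Pseudovariety) {S T : Type} [Semigroup S] [Finite S] [Nonempty S]
    [Semigroup T] [Finite T] [Nonempty T] (φ : S →ₙ* T) (hφ : Function.Injective φ)
    (hT : V.Mem T) : V.Mem S := by
  have : Nonempty φ.srange := ⟨⟨_, Classical.arbitrary S, rfl⟩⟩
  let ψ : S ≃* φ.srange := MulEquiv.ofBijective φ.srangeRestrict
    ⟨fun a b h => hφ (congrArg Subtype.val h), φ.srangeRestrict_surjective⟩
  exact V.image φ.srange S ψ.symm.toMulHom ψ.symm.surjective (V.sub T φ.srange hT)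

theorem mem_prod (V : Pseudovariety) {S T : Type} [Semigroup S] [Finite S] [Nonempty S]
    [Semigroup T] [Finite T] [Nonempty T] (hS : V.Mem S) (hT : V.Mem T) : V.Mem (S × T) := by
  let F : Fin 2 → Type := ![S, T]
  let _ : ∀ i, Semigroup (F i) := Fin.cons ‹Semigroup S› (Fin.cons ‹Semigroup T› finZeroElim)
  have _ : ∀ i, Finite (F i) := Fin.cons ‹Finite S› (Fin.cons ‹Finite T› finZeroElim)
  have _ : ∀ i, Nonempty (F i) := Fin.cons ‹Nonempty S› (Fin.cons ‹Nonempty T› finZeroElim)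
  have hF : V.Mem (∀ i, F i) := V.pi 2 F (Fin.cons hS (Fin.cons hT finZeroElim))
  refine V.image (∀ i, F i) (S × T) ⟨fun p => (p 0, p 1), fun _ _ => rfl⟩ ?_ hF
  rintro ⟨s, t⟩
  exact ⟨Fin.cons s (Fin.cons t finZeroElim), rfl⟩

end Pseudovariety

/-! ### Brandt semigroups over monoids -/

/-- The semigroup of `2 × 2` matrix units with coefficients in `M`, with a zero. -/
inductive BrandtTwo (M : Type) : Type
  | zero
  | unit (i : Bool) (m : M) (j : Bool)

namespace BrandtTwo

variable {M : Type}

/-- The multiplication of matrix units. -/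
def mul [Monoid M] : BrandtTwo M → BrandtTwo M → BrandtTwo M
  | unit i m j, unit k n l => if j = k then unit i (m * n) l else zero
  | _, _ => zero

theorem mul_zero' [Monoid M] (x : BrandtTwo M) : mul x zero = zero := by cases x <;> rfl

theorem mul_assoc' [Monoid M] (x y z : BrandtTwo M) : mul (mul x y) z = mul x (mul y z) := by
  cases x with
  | zero => rfl
  | unit i m j =>
    cases y with
    | zero => rfl
    | unit k n l =>
      cases z with
      | zero => rw [mul_zero', mul_zero', mul_zero']
      | unit p q r => by_cases hjk : j = k <;> by_cases hlp : l = p <;>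
          simp [mul, hjk, hlp, mul_assoc]

instance [Monoid M] : Semigroup (BrandtTwo M) where
  mul := mul
  mul_assoc := mul_assoc'

instance [Finite M] : Finite (BrandtTwo M) := by
  let g : BrandtTwo M → Option (Bool × M × Bool)
    | zero => none
    | unit i m j => some (i, m, j)
  refine Finite.of_injective g fun x y h => ?_
  cases x <;> cases y <;> simp_all [g]

instance : Nonempty (BrandtTwo M) := ⟨zero⟩

theorem unit_mul_unit [Monoid M] (i j k : Bool) (m n : M) :
    unit i m j * unit j n k = unit i (m * n) k := if_pos rfl

end BrandtTwo

/-- The generalization of `Y` in which `a` is replaced by a family of elements. -/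
inductive YFamily (M : Type) : Type
  | ab
  | a (m : M)
  | ba
  | zero

namespace YFamily

variable {M : Type}

/-- The multiplication of `YFamily M`; all products not listed are zero. -/
def mul : YFamily M → YFamily M → YFamily M
  | ab, ab => ab
  | ab, a m => a m
  | a m, ba => a m
  | ba, ba => ba
  | _, _ => zero

instance : Semigroup (YFamily M) where
  mul := mul
  mul_assoc x y z := by cases x <;> cases y <;> cases z <;> rfl

theorem mul_def (x y : YFamily M) : x * y = mul x y := rfl

instance : Nonempty (YFamily M) := ⟨zero⟩

/-- The embedding of `YFamily M` as a semigroup of upper triangular matrix units. -/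
def toBrandt (M : Type) [Monoid M] : YFamily M →ₙ* BrandtTwo M where
  toFun
    | ab => BrandtTwo.unit false 1 false
    | a m => BrandtTwo.unit false m true
    | ba => BrandtTwo.unit true 1 true
    | zero => BrandtTwo.zero
  map_mul' x y := by
    change _ = BrandtTwo.mul _ _
    cases x <;> cases y <;> simp [BrandtTwo.mul, mul_def, mul]

theorem toBrandt_injective [Monoid M] : Function.Injective (toBrandt M) := by
  intro x y h
  cases x <;> cases y <;> simp_all [toBrandt]

instance [Finite M] : Finite (YFamily M) := by
  let g : YFamily M → Option (Option (Option M))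
    | ab => none
    | ba => some none
    | zero => some (some none)
    | a m => some (some (some m))
  refine Finite.of_injective g fun x y h => ?_
  cases x <;> cases y <;> simp_all [g]

theorem toBrandt_not_surjective [Monoid M] : ¬ Function.Surjective (toBrandt M) := by
  intro h
  obtain ⟨x, hx⟩ := h (BrandtTwo.unit true 1 false)
  cases x <;> simp_all [toBrandt]

theorem Dom_srange_toBrandt [Monoid M] : Dom (toBrandt M).srange = Set.univ := by
  refine Set.eq_univ_of_forall fun d T _ α β hαβ => ?_
  have hU : ∀ y : YFamily M, α (toBrandt M y) = β (toBrandt M y) := fun y => hαβ _ ⟨y, rfl⟩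
  have hab : α (BrandtTwo.unit false 1 false) = β (BrandtTwo.unit false 1 false) := hU ab
  have hba : α (BrandtTwo.unit true 1 true) = β (BrandtTwo.unit true 1 true) := hU ba
  have ha : ∀ m, α (BrandtTwo.unit false m true) = β (BrandtTwo.unit false m true) :=
    fun m => hU (a m)
  have mulα := fun i j k (m n : M) =>
    (map_mul α (BrandtTwo.unit i m j) (BrandtTwo.unit j n k)).symm
  have mulβ := fun i j k (m n : M) =>
    (map_mul β (BrandtTwo.unit i m j) (BrandtTwo.unit j n k)).symm
  simp only [BrandtTwo.unit_mul_unit] at mulα mulβ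
  -- The zigzag `α(b) = β(ba)α(b) = β(b)α(a)α(b) = β(b)β(ab) = β(b)`.
  have hb : α (BrandtTwo.unit true 1 false) = β (BrandtTwo.unit true 1 false) := by
    have h1 := mulα true true false 1 1
    have h2 := mulβ true false true 1 1
    have h3 := mulα false true false 1 1
    have h4 := mulβ true false false 1 1
    simp only [mul_one] at h1 h2 h3 h4
    rw [← h1, hba, ← h2, mul_assoc, ← ha, h3, hab, h4]
  have h11 : ∀ m, α (BrandtTwo.unit false m false) = β (BrandtTwo.unit false m false) := by
    intro m
    have h1 := mulα false true false m 1
    have h2 := mulβ false true false m 1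
    rw [mul_one] at h1 h2
    rw [← h1, ← h2, ha, hb]
  have h2 : ∀ m j, α (BrandtTwo.unit true m j) = β (BrandtTwo.unit true m j) := by
    intro m j
    have h1 := mulα true false j 1 m
    have h2 := mulβ true false j 1 m
    rw [one_mul] at h1 h2
    rw [← h1, ← h2, hb]
    cases j
    · rw [h11]
    · rw [ha]
  cases d with
  | zero => exact hU zero
  | unit i m j =>
    cases i
    · cases j
      · exact h11 m
      · exact ha m
    · exact h2 m j

/-- The morphism to `Y` that keeps the element indexed by `m` and kills the others. -/
def toY [DecidableEq M] (m : M) : YFamily M →ₙ* Y where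
  toFun
    | ab => Y.ab
    | a n => if n = m then Y.a else Y.zero
    | ba => Y.ba
    | zero => Y.zero
  map_mul' x y := by
    cases x <;> cases y <;> simp only [mul_def, mul] <;> (try split_ifs) <;> rfl

end YFamily

/-! ### Pseudovarieties containing `Y` -/

namespace Pseudovariety

/-- The morphisms `toY m` jointly separate points; `M` must be nonempty for them to separate `ab`,
`ba` and `zero`. -/
theorem mem_YFamily {V : Pseudovariety} (hY : V.Mem Y) (M : Type) [Finite M] [Nonempty M] :
    V.Mem (YFamily M) := by
  classical
  obtain ⟨n, ⟨e⟩⟩ := Finite.exists_equiv_fin M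
  refine V.mem_of_injective (T := Fin n → Y)
    ⟨fun x i => YFamily.toY (e.symm i) x, fun x y => funext fun i => map_mul _ _ _⟩ ?_
    (V.pi n (fun _ => Y) fun _ => hY)
  intro x y h
  have h' : ∀ m : M, YFamily.toY m x = YFamily.toY m y := fun m => by
    simpa using congrFun h (e m)
  obtain ⟨m₀⟩ := ‹Nonempty M›
  cases x with
  | a m =>
    have := h' m
    cases y <;> simp_all [YFamily.toY]
  | _ =>
    cases y with
    | a m => have := h' m; simp_all [YFamily.toY]
    | _ => have := h' m₀; simp_all [YFamily.toY]

theorem not_fSaturated_of_mem_Y {V : Pseudovariety} (hY : V.Mem Y) : ¬ V.FSaturated :=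
  fun h => h (YFamily Unit) (mem_YFamily hY Unit) (BrandtTwo Unit) (YFamily.toBrandt Unit)
    YFamily.toBrandt_injective YFamily.toBrandt_not_surjective YFamily.Dom_srange_toBrandt

/-- `S` embeds in a diagonal corner of the matrix units over `WithOne S`. -/
theorem mem_of_mem_Y {W : Pseudovariety} (hW : W.FEpimorphicallyClosed) (hY : W.Mem Y)
    (S : Type) [Semigroup S] [Finite S] [Nonempty S] : W.Mem S := by
  have : Finite (WithOne S) := inferInstanceAs (Finite (Option S))
  have hB : W.Mem (BrandtTwo (WithOne S)) :=
    hW _ _ (YFamily.toBrandt (WithOne S))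
      ((Dom_srange_eq_univ_iff_epi _).1 YFamily.Dom_srange_toBrandt) (mem_YFamily hY _)
  refine W.mem_of_injective (T := BrandtTwo (WithOne S))
    ⟨fun s => BrandtTwo.unit false (s : WithOne S) false, fun s t => ?_⟩ ?_ hB
  · rw [BrandtTwo.unit_mul_unit, WithOne.coe_mul]
  · intro s t h
    simpa using h

theorem eq_allFinite {W : Pseudovariety}
    (h : ∀ (S : Type) [Semigroup S] [Finite S] [Nonempty S], W.Mem S) : W = allFinite := by
  obtain ⟨Mem, _, _, _⟩ := W
  unfold allFinite
  congr 1
  funext S _ _ _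
  exact eq_true (h S)

theorem allFinite_of_mem_Y {V : Pseudovariety} (hY : V.Mem Y) (W : Pseudovariety) :
    (W.FEpimorphicallyClosed ∧ V ≤ W) ↔ W = allFinite := by
  constructor
  · rintro ⟨hW, hVW⟩
    exact eq_allFinite fun S => mem_of_mem_Y hW (hVW Y hY) S
  · rintro rfl
    exact ⟨fun _ _ _ _ _ _ _ _ _ _ _ => trivial, fun _ _ _ _ _ => trivial⟩

end Pseudovariety

/-! ### Deciding F-saturation -/

/-- An enumeration of `Y`. -/
def finEquivY : Fin 4 ≃ Y where
  toFun := ![Y.ab, Y.a, Y.ba, Y.zero]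
  invFun
    | Y.ab => 0
    | Y.a => 1
    | Y.ba => 2
    | Y.zero => 3
  left_inv i := by fin_cases i <;> rfl
  right_inv y := by cases y <;> rfl

/-- Run a program on the multiplication table of `Y` and test whether it returns `0`. -/
def rejectsY (c : Nat.Partrec.Code) : Part Bool :=
  (c.eval (Encodable.encode (mulTable finEquivY))).map fun n => decide (n = 0)

theorem partrec_rejectsY : Partrec rejectsY := by
  refine Partrec.map (Nat.Partrec.Code.eval_part.comp Computable.id (Computable.const _)) ?_
  have h : PrimrecPred fun n : ℕ => n = 0 := Primrec.eq.comp Primrec.id (Primrec.const 0)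
  exact (h.decide.to_comp.comp Computable.snd).to₂

theorem rejectsY_spec {V : Pseudovariety} {c : Nat.Partrec.Code} (h : DecidesMembership c V) :
    (¬ V.Mem Y → true ∈ rejectsY c) ∧ (V.Mem Y → false ∈ rejectsY c) :=
  ⟨fun hY => (Part.mem_map_iff _).2 ⟨0, (h Y 4 finEquivY).2 hY, rfl⟩,
    fun hY => (Part.mem_map_iff _).2 ⟨1, (h Y 4 finEquivY).1 hY, rfl⟩⟩

/-! ### Divisibility by `Y` -/

/-- The subsemigroup of `P × Y` generated by `(e, ab)`, `(s, a)` and `(f, ba)`, as a relation. -/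
inductive YWord {P : Type} [Semigroup P] (e s f : P) : P → Y → Prop
  | e : YWord e s f e Y.ab
  | s : YWord e s f s Y.a
  | f : YWord e s f f Y.ba
  | e_mul {p y} : YWord e s f p y → YWord e s f (e * p) (Y.ab * y)
  | s_mul {p y} : YWord e s f p y → YWord e s f (s * p) (Y.a * y)
  | f_mul {p y} : YWord e s f p y → YWord e s f (f * p) (Y.ba * y)

namespace YWord

variable {P : Type} [Semigroup P] {e s f : P}

theorem mul {p q : P} {y z : Y} (h : YWord e s f p y) (h' : YWord e s f q z) :
    YWord e s f (p * q) (y * z) := by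
  induction h with
  | e => exact h'.e_mul
  | s => exact h'.s_mul
  | f => exact h'.f_mul
  | e_mul _ ih => rw [mul_assoc, mul_assoc]; exact ih.e_mul
  | s_mul _ ih => rw [mul_assoc, mul_assoc]; exact ih.s_mul
  | f_mul _ ih => rw [mul_assoc, mul_assoc]; exact ih.f_mul

variable (he : e * e = e) (hf : f * f = f) (hes : e * s = s) (hsf : s * f = s)

include he hf hes hsf

theorem value {p : P} {y : Y} (h : YWord e s f p y) :
    (y = Y.ab → p = e) ∧ (y = Y.a → p = s) ∧ (y = Y.ba → p = f) := by
  induction h with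
  | e => simp
  | s => simp
  | f => simp
  | @e_mul p y _ ih =>
    cases y
    · exact ⟨fun _ => by rw [ih.1 rfl, he], nofun, nofun⟩
    · exact ⟨nofun, fun _ => by rw [ih.2.1 rfl, hes], nofun⟩
    all_goals exact ⟨nofun, nofun, nofun⟩
  | @s_mul p y _ ih =>
    cases y
    case ba => exact ⟨nofun, fun _ => by rw [ih.2.2 rfl, hsf], nofun⟩
    all_goals exact ⟨nofun, nofun, nofun⟩
  | @f_mul p y _ ih =>
    cases y
    case ba => exact ⟨nofun, nofun, fun _ => by rw [ih.2.2 rfl, hf]⟩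
    all_goals exact ⟨nofun, nofun, nofun⟩

/-- Reading a word from the right, its value in `Y` first becomes zero at one of the five zero
products of two nonzero generators; the suffix before that evaluates in `P` to a single generator.
-/
theorem zero_induction {C : P → Prop} (hef : C (e * f)) (hse : C (s * e)) (hss : C (s * s))
    (hfe : C (f * e)) (hfs : C (f * s)) (hCe : ∀ p, C p → C (e * p))
    (hCs : ∀ p, C p → C (s * p)) (hCf : ∀ p, C p → C (f * p)) {p : P}
    (h : YWord e s f p Y.zero) : C p := by
  suffices H : ∀ {p y}, YWord e s f p y → y = Y.zero → C p from H h rfl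
  intro p y h
  induction h with
  | e => exact nofun
  | s => exact nofun
  | f => exact nofun
  | @e_mul p y h ih =>
    have hv := value he hf hes hsf h
    cases y
    · exact nofun
    · exact nofun
    · exact fun _ => hv.2.2 rfl ▸ hef
    · exact fun _ => hCe _ (ih rfl)
  | @s_mul p y h ih =>
    have hv := value he hf hes hsf h
    cases y
    · exact fun _ => hv.1 rfl ▸ hse
    · exact fun _ => hv.2.1 rfl ▸ hss
    · exact nofun
    · exact fun _ => hCs _ (ih rfl)
  | @f_mul p y h ih =>
    have hv := value he hf hes hsf h
    cases y
    · exact fun _ => hv.1 rfl ▸ hfe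
    · exact fun _ => hv.2.1 rfl ▸ hfs
    · exact nofun
    · exact fun _ => hCf _ (ih rfl)

/-- Any ambiguity in the second coordinate propagates, through `e * s = s` or `s * f = s`, to a word
with value `s` in `P` and zero in `Y`. Without such a word the relation is a partial map from `P`
onto `Y`, so `Y` divides `P`. -/
theorem snd_unique (hs : ¬ YWord e s f s Y.zero) {p : P} {y z : Y} (hy : YWord e s f p y)
    (hz : YWord e s f p z) : y = z := by
  have hab : ∀ z, YWord e s f e z → z = Y.ab := by
    intro z hz
    have := hz.mul YWord.s
    rw [hes] at this
    cases z
    · rfl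
    all_goals exact absurd this hs
  have hba : ∀ z, YWord e s f f z → z = Y.ba := by
    intro z hz
    have := YWord.s.mul hz
    rw [hsf] at this
    cases z
    case ba => rfl
    all_goals exact absurd this hs
  have hy' := value he hf hes hsf hy
  have hz' := value he hf hes hsf hz
  cases y with
  | ab => exact (hab z (hy'.1 rfl ▸ hz)).symm
  | ba => exact (hba z (hy'.2.2 rfl ▸ hz)).symm
  | a =>
    cases z with
    | ab => exact hab _ (hz'.1 rfl ▸ hy)
    | ba => exact hba _ (hz'.2.2 rfl ▸ hy)
    | a => rfl
    | zero => exact absurd (hy'.2.1 rfl ▸ hz) hs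
  | zero =>
    cases z with
    | ab => exact hab _ (hz'.1 rfl ▸ hy)
    | ba => exact hba _ (hz'.2.2 rfl ▸ hy)
    | a => exact absurd (hz'.2.1 rfl ▸ hy) hs
    | zero => rfl

theorem mem_Y [Finite P] [Nonempty P] {V : Pseudovariety} (hP : V.Mem P)
    (hs : ¬ YWord e s f s Y.zero) : V.Mem Y := by
  let R : Subsemigroup (P × Y) :=
    { carrier := {p | YWord e s f p.1 p.2}
      mul_mem' := fun h h' => YWord.mul h h' }
  have : Nonempty R := ⟨⟨(e, Y.ab), YWord.e⟩⟩
  have hR : V.Mem R := by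
    refine V.mem_of_injective ((MulHom.fst P Y).comp (MulMemClass.subtype R)) ?_ hP
    rintro ⟨⟨p, y⟩, hy⟩ ⟨⟨q, z⟩, hz⟩ h
    obtain rfl : p = q := h
    obtain rfl : y = z := snd_unique he hf hes hsf hs hy hz
    rfl
  refine V.image R Y ((MulHom.snd P Y).comp (MulMemClass.subtype R)) ?_ hR
  rintro (_ | _ | _ | _)
  · exact ⟨⟨(e, Y.ab), YWord.e⟩, rfl⟩
  · exact ⟨⟨(s, Y.a), YWord.s⟩, rfl⟩
  · exact ⟨⟨(f, Y.ba), YWord.f⟩, rfl⟩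
  · exact ⟨⟨(s * s, Y.zero), YWord.s.s_mul⟩, rfl⟩

end YWord

/-! ### Absorbing an `ω`-power -/

section Omega

variable {S : Type} [Semigroup S] [Finite S]

theorem exists_coe_omegaPow (a : S) :
    ∃ n, ((omegaPow a : S) : WithOne S) = (a : WithOne S) ^ (n + 1) := by
  obtain ⟨n, hn⟩ := omegaPow_eq_ppow a
  exact ⟨n, by rw [← hn, coe_ppow]⟩

/-- Thus an element fixed by any positive power of `a` is fixed by the `ω`-power. -/
theorem exists_coe_omegaPow_multiple (a : S) (m : ℕ) :
    ∃ n, ((omegaPow a : S) : WithOne S) = ((a : WithOne S) ^ (m + 1)) ^ (n + 1) := by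
  obtain ⟨n, hn⟩ := exists_coe_omegaPow a
  have h : IsIdempotentElem ((omegaPow a : S) : WithOne S) := by
    rw [IsIdempotentElem, ← WithOne.coe_mul, (omegaPow_idempotent a).eq]
  refine ⟨n, ?_⟩
  rw [← h.pow_succ_eq m, hn, ← pow_mul, ← pow_mul, mul_comm]

theorem omegaPow_mul_eq {a s : S} {m : ℕ} (h : (a : WithOne S) ^ (m + 1) * s = s) :
    omegaPow a * s = s := by
  obtain ⟨n, hn⟩ := exists_coe_omegaPow_multiple a m
  apply WithOne.coe_inj.1
  rw [WithOne.coe_mul, hn]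
  generalize n + 1 = k
  induction k with
  | zero => simp
  | succ k ih => rw [pow_succ, mul_assoc, h, ih]

theorem mul_omegaPow_eq {a s : S} {m : ℕ} (h : s * (a : WithOne S) ^ (m + 1) = s) :
    s * omegaPow a = s := by
  obtain ⟨n, hn⟩ := exists_coe_omegaPow_multiple a m
  apply WithOne.coe_inj.1
  rw [WithOne.coe_mul, hn]
  generalize n + 1 = k
  induction k with
  | zero => simp
  | succ k ih => rw [pow_succ', ← mul_assoc, h, ih]

theorem omegaPow_mul_self_eq {s : S} {m : ℕ} (h : (s : WithOne S) ^ (m + 2) = s) :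
    omegaPow s * s = s :=
  omegaPow_mul_eq (m := m) (by rw [← pow_succ, h])

end Omega

/-! ### Pseudovarieties without `Y` -/

section Exclusion

theorem mul_mul_eq_of_mul_eq {M : Type} [Semigroup M] {a b c : M} (h : a * b = c) (x : M) :
    a * (b * x) = c * x := by rw [← mul_assoc, h]

variable {V : Pseudovariety} (hY : ¬ V.Mem Y)

include hY

theorem omegaPow_mul_self_of_idempotents {S : Type} [Semigroup S] [Finite S] [Nonempty S]
    (hS : V.Mem S) {e f : S} (he : IsIdempotentElem e) (hf : IsIdempotentElem f) :
    omegaPow (e * f) * (e * f) = e * f := by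
  by_contra hgrp
  have hno : ∀ m, ((e * f : S) : WithOne S) ^ (m + 2) ≠ (e * f : S) :=
    fun m h => hgrp (omegaPow_mul_self_eq h)
  have hee := mul_mul_eq_of_mul_eq he.eq
  have hE : (e : WithOne S) * e = e := by rw [← WithOne.coe_mul, he.eq]
  have hF : (f : WithOne S) * f = f := by rw [← WithOne.coe_mul, hf.eq]
  have hEE := mul_mul_eq_of_mul_eq hE
  have hFF := mul_mul_eq_of_mul_eq hF
  -- The second coordinate separates the middle generator from the zero word `(e, e) * (f, f)`,
  -- which has the same first coordinate.
  refine hY (YWord.mem_Y (P := S × S) (e := (e, e)) (f := (f, f)) (s := (e * f, e * f * (e * f)))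
    (by simp [he.eq]) (by simp [hf.eq]) (by simp [mul_assoc, hee])
    (by simp [mul_assoc, hf.eq]) (V.mem_prod hS hS) fun hw => ?_)
  -- Multiplying by `f` on the right normalizes words ending in `e`. Any other zero word then has a
  -- first coordinate that forces `e * f` to be a higher power of itself.
  have key := YWord.zero_induction (C := fun p : S × S => p = (e * f, e * f) ∨
      (∃ n, (p.1 : WithOne S) * f = (e * f) ^ (n + 2)) ∨
      ∃ n, (p.1 : WithOne S) * f = f * (e * f) ^ (n + 1))
    (by simp [he.eq]) (by simp [hf.eq]) (by simp [mul_assoc, hee]) (by simp [mul_assoc, hf.eq])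
    (Or.inl rfl)
    (Or.inr (Or.inl ⟨0, by simp [pow_succ, mul_assoc]⟩))
    (Or.inr (Or.inl ⟨0, by simp [pow_succ, mul_assoc, hF]⟩))
    (Or.inr (Or.inr ⟨0, by simp [mul_assoc]⟩))
    (Or.inr (Or.inr ⟨0, by simp [mul_assoc, hF]⟩))
    (by
      rintro p (rfl | ⟨n, hn⟩ | ⟨n, hn⟩)
      · exact Or.inl (by simp [hee])
      · refine Or.inr (Or.inl ⟨n, ?_⟩)
        simp only [Prod.fst_mul, WithOne.coe_mul]
        rw [mul_assoc, hn, pow_succ', mul_assoc, hEE]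
      · refine Or.inr (Or.inl ⟨n, ?_⟩)
        simp only [Prod.fst_mul, WithOne.coe_mul]
        rw [mul_assoc, hn, pow_succ' _ (n + 1), mul_assoc])
    (by
      rintro p (rfl | ⟨n, hn⟩ | ⟨n, hn⟩)
      · exact Or.inr (Or.inl ⟨0, by simp [pow_succ, mul_assoc, hF]⟩)
      · refine Or.inr (Or.inl ⟨n + 1, ?_⟩)
        simp only [Prod.fst_mul, WithOne.coe_mul]
        rw [mul_assoc, hn, ← pow_succ']
      · refine Or.inr (Or.inl ⟨n, ?_⟩)
        simp only [Prod.fst_mul, WithOne.coe_mul]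
        rw [mul_assoc, hn, mul_assoc, hFF, pow_succ' _ (n + 1), mul_assoc])
    (by
      rintro p (rfl | ⟨n, hn⟩ | ⟨n, hn⟩)
      · exact Or.inr (Or.inr ⟨0, by simp [mul_assoc, hF]⟩)
      · refine Or.inr (Or.inr ⟨n + 1, ?_⟩)
        simp only [Prod.fst_mul, WithOne.coe_mul]
        rw [mul_assoc, hn]
      · refine Or.inr (Or.inr ⟨n, ?_⟩)
        simp only [Prod.fst_mul, WithOne.coe_mul]
        rw [mul_assoc, hn, hFF]) hw
  simp only [WithOne.coe_mul] at hno
  rcases key with h | ⟨n, hn⟩ | ⟨n, hn⟩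
  · have := congrArg (fun p : S × S => (p.2 : WithOne S)) h
    refine hno 0 ?_
    simpa [pow_succ, mul_assoc] using this
  · refine hno n ?_
    rw [← hn]
    simp [mul_assoc, hF]
  · refine hno n ?_
    rw [pow_succ' _ (n + 1), mul_assoc, ← hn]
    simp [mul_assoc, hF, hEE]

theorem omegaPow_mul_self_of_local {S : Type} [Semigroup S] [Finite S] [Nonempty S]
    (hS : V.Mem S)
    (hloc : ∀ g x : S, IsIdempotentElem g → omegaPow (g * x * g) * (g * x * g) = g * x * g)
    {e f s : S} (he : IsIdempotentElem e) (hf : IsIdempotentElem f) (hes : e * s = s)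
    (hsf : s * f = s) : omegaPow s * s = s := by
  by_contra hgrp
  have hno : ∀ m, (s : WithOne S) ^ (m + 2) ≠ s := fun m h => hgrp (omegaPow_mul_self_eq h)
  have : Finite (WithOne S) := inferInstanceAs (Finite (Option S))
  have hE : (e : WithOne S) * e = e := by rw [← WithOne.coe_mul, he.eq]
  have hF : (f : WithOne S) * f = f := by rw [← WithOne.coe_mul, hf.eq]
  have hES : (e : WithOne S) * s = s := by rw [← WithOne.coe_mul, hes]
  have hSF : (s : WithOne S) * f = s := by rw [← WithOne.coe_mul, hsf]
  have hEE := mul_mul_eq_of_mul_eq hE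
  have hFF := mul_mul_eq_of_mul_eq hF
  have hSFF := mul_mul_eq_of_mul_eq hSF
  -- Otherwise `s` is `R`-equivalent to `s * e = e * s * e`, a group element by `hloc`. Its
  -- idempotent power fixes `s`, while `(s * e) ^ k * s = s ^ (k + 1)`.
  have hse : ∀ a b : WithOne S, (s : WithOne S) ≠ a * (s * (e * b)) := by
    intro a b h
    obtain ⟨n, hn⟩ := exists_eq_mul_pow (x := (s : WithOne S)) (u := a) (v := e * b)
      (by rw [mul_assoc]; exact h)
    have hgr := hloc e s he
    rw [hes] at hgr
    obtain ⟨k, hk⟩ := exists_coe_omegaPow (s * e)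
    have hgr' := congrArg (fun t : S => (t : WithOne S)) hgr
    simp only [WithOne.coe_mul, hk] at hgr'
    have hpow : ∀ k, ((s : WithOne S) * e) ^ k * s = s ^ (k + 1) := by
      intro k
      induction k with
      | zero => simp
      | succ k ih => rw [pow_succ, mul_assoc, mul_assoc, hES, ← mul_assoc, ih, ← pow_succ]
    have hs : (s : WithOne S) = s * e * (b * (e * b) ^ n) := by
      conv_lhs => rw [hn, pow_succ']
      simp only [mul_assoc]
    refine hno k ((hpow (k + 1)).symm.trans ?_)
    calc ((s : WithOne S) * e) ^ (k + 1) * s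
        = (s * e) ^ (k + 1) * (s * e * (b * (e * b) ^ n)) := congrArg _ hs
      _ = s := by rw [← mul_assoc, hgr', ← hs]
  have hfs : ∀ a b : WithOne S, (s : WithOne S) ≠ a * (f * (s * b)) := by
    intro a b h
    obtain ⟨n, hn⟩ := exists_eq_pow_mul (x := (s : WithOne S)) (u := a * f) (v := b)
      (by simp only [mul_assoc]; exact h)
    have hgr := hloc f s hf
    rw [mul_assoc, hsf] at hgr
    obtain ⟨k, hk⟩ := exists_coe_omegaPow (f * s)
    have hgr' := congrArg (fun t : S => (t : WithOne S)) hgr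
    simp only [WithOne.coe_mul, hk] at hgr'
    rw [← pow_succ, pow_succ'] at hgr'
    have hpow : ∀ k, (s : WithOne S) * (f * s) ^ k = s ^ (k + 1) := by
      intro k
      induction k with
      | zero => simp
      | succ k ih => 
        rw [pow_succ, ← mul_assoc, ih, ← mul_assoc, pow_succ, mul_assoc _ _ (f : WithOne S), hSF,
          ← pow_succ, ← pow_succ]
    have hs : (s : WithOne S) = (a * f) ^ n * a * (f * s) := by
      conv_lhs => rw [hn, pow_succ]
      simp only [mul_assoc]
    refine hno k ((hpow (k + 1)).symm.trans ?_)
    calc (s : WithOne S) * (f * s) ^ (k + 1)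
        = (a * f) ^ n * a * (f * s) * (f * s) ^ (k + 1) := congrArg (· * _) hs
      _ = s := by rw [mul_assoc, hgr', ← hs]
  refine hY (YWord.mem_Y (P := S) he.eq hf.eq hes hsf hS fun hw => ?_)
  -- A zero word, multiplied by `f`, is a power of `e * f`, possibly preceded by `f`, or contains a
  -- factor `s * e` or `f * s`. Powers of `e * f` are group elements by the preceding lemma.
  have key := YWord.zero_induction (C := fun p : S =>
      (∃ n, (p : WithOne S) * f = (e * f) ^ (n + 1)) ∨
      (∃ n, (p : WithOne S) * f = f * (e * f) ^ (n + 1)) ∨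
      (∃ a b, (p : WithOne S) * f = a * (s * (e * b))) ∨
      ∃ a b, (p : WithOne S) * f = a * (f * (s * b)))
    he.eq hf.eq hes hsf
    (Or.inl ⟨0, by simp [mul_assoc, hF]⟩)
    (Or.inr (Or.inr (Or.inl ⟨1, f, by simp [mul_assoc]⟩)))
    (Or.inr (Or.inr (Or.inl ⟨1, s, by simp [mul_assoc, hSF, hES]⟩)))
    (Or.inr (Or.inl ⟨0, by simp [mul_assoc]⟩))
    (Or.inr (Or.inr (Or.inr ⟨1, f, by simp [mul_assoc]⟩)))
    (by
      rintro p (⟨n, hn⟩ | ⟨n, hn⟩ | ⟨a, b, hn⟩ | ⟨a, b, hn⟩)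
      · refine Or.inl ⟨n, ?_⟩
        rw [WithOne.coe_mul, mul_assoc, hn, pow_succ', mul_assoc, hEE]
      · refine Or.inl ⟨n + 1, ?_⟩
        rw [WithOne.coe_mul, mul_assoc, hn, pow_succ' _ (n + 1), mul_assoc]
      · exact Or.inr (Or.inr (Or.inl ⟨e * a, b, by
          rw [WithOne.coe_mul, mul_assoc, hn, mul_assoc]⟩))
      · exact Or.inr (Or.inr (Or.inr ⟨e * a, b, by
          rw [WithOne.coe_mul, mul_assoc, hn, mul_assoc]⟩)))
    (by
      rintro p (⟨n, hn⟩ | ⟨n, hn⟩ | ⟨a, b, hn⟩ | ⟨a, b, hn⟩)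
      · refine Or.inr (Or.inr (Or.inl ⟨1, f * (e * f) ^ n, ?_⟩))
        rw [WithOne.coe_mul, mul_assoc, hn, pow_succ', one_mul, mul_assoc]
      · refine Or.inr (Or.inr (Or.inl ⟨1, f * (e * f) ^ n, ?_⟩))
        rw [WithOne.coe_mul, mul_assoc, hn, hSFF, pow_succ', one_mul, mul_assoc]
      · exact Or.inr (Or.inr (Or.inl ⟨s * a, b, by
          rw [WithOne.coe_mul, mul_assoc, hn, mul_assoc]⟩))
      · exact Or.inr (Or.inr (Or.inr ⟨s * a, b, by
          rw [WithOne.coe_mul, mul_assoc, hn, mul_assoc]⟩)))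
    (by
      rintro p (⟨n, hn⟩ | ⟨n, hn⟩ | ⟨a, b, hn⟩ | ⟨a, b, hn⟩)
      · exact Or.inr (Or.inl ⟨n, by rw [WithOne.coe_mul, mul_assoc, hn]⟩)
      · exact Or.inr (Or.inl ⟨n, by rw [WithOne.coe_mul, mul_assoc, hn, hFF]⟩)
      · exact Or.inr (Or.inr (Or.inl ⟨f * a, b, by
          rw [WithOne.coe_mul, mul_assoc, hn, mul_assoc]⟩))
      · exact Or.inr (Or.inr (Or.inr ⟨f * a, b, by
          rw [WithOne.coe_mul, mul_assoc, hn, mul_assoc]⟩)))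
    hw
  have hefgrp : ∀ n, (s : WithOne S) ≠ (e * f) ^ (n + 1) := by
    intro n hn
    obtain ⟨k, hk⟩ := exists_coe_omegaPow (e * f)
    have hgr' := congrArg (fun t : S => (t : WithOne S))
      (omegaPow_mul_self_of_idempotents hY hS he hf)
    simp only [WithOne.coe_mul, hk] at hgr'
    have hab : ∀ m, ((e : WithOne S) * f) ^ (k + 1) * (e * f) ^ (m + 1) = (e * f) ^ (m + 1) := by
      intro m
      rw [pow_succ' _ m, ← mul_assoc, hgr']
    have hall : ∀ m, (((e : WithOne S) * f) ^ (k + 1)) ^ m * s = s := by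
      intro m
      induction m with
      | zero => simp
      | succ m ih => rw [pow_succ, mul_assoc, hn, hab, ← hn, ih]
    refine hno k ?_
    rw [pow_succ]
    conv_lhs => rw [hn, ← pow_mul, mul_comm, pow_mul, ← hn]
    exact hall _
  rcases key with ⟨n, hn⟩ | ⟨n, hn⟩ | ⟨a, b, hn⟩ | ⟨a, b, hn⟩
  · exact hefgrp n (by rw [← hn, hSF])
  · refine hefgrp (n + 1) ?_
    rw [pow_succ' _ (n + 1), mul_assoc, ← hn, hSF, hES]
  · exact hse a b (by rw [← hn, hSF])
  · exact hfs a b (by rw [← hn, hSF])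

/-- The element `t` counts occurrences of `s`: with generators `(g, e)`, `(t, s)`, `(g, f)`, a word
with first coordinate `t` contains `s` exactly once, as `t` is neither `g` nor a higher power of
itself. A zero word equal to `(t, s)` then yields `s = (ef)^i s (ef)^j` with `i + j > 0`. -/
theorem mul_omegaPow_or_omegaPow_mul {S R : Type} [Semigroup S] [Finite S] [Nonempty S]
    [Semigroup R] [Finite R] [Nonempty R] (hS : V.Mem S) (hR : V.Mem R) {g t : S}
    (hg : IsIdempotentElem g) (hgt : g * t = t) (htg : t * g = t) (ht : omegaPow t * t ≠ t)
    {e f s : R} (he : IsIdempotentElem e) (hf : IsIdempotentElem f) (hes : e * s = s)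
    (hsf : s * f = s) : s * omegaPow (e * f) = s ∨ omegaPow (e * f) * s = s := by
  by_contra hcon
  have hno : ∀ m, (t : WithOne S) ^ (m + 2) ≠ t := fun m h => ht (omegaPow_mul_self_eq h)
  have : Finite (WithOne R) := inferInstanceAs (Finite (Option R))
  have hE : (e : WithOne R) * e = e := by rw [← WithOne.coe_mul, he.eq]
  have hF : (f : WithOne R) * f = f := by rw [← WithOne.coe_mul, hf.eq]
  have hES : (e : WithOne R) * s = s := by rw [← WithOne.coe_mul, hes]
  have hSF : (s : WithOne R) * f = s := by rw [← WithOne.coe_mul, hsf]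
  have hGT : (g : WithOne S) * t = t := by rw [← WithOne.coe_mul, hgt]
  have hEE := mul_mul_eq_of_mul_eq hE
  have hFF := mul_mul_eq_of_mul_eq hF
  have hESS := mul_mul_eq_of_mul_eq hES
  have hSFF := mul_mul_eq_of_mul_eq hSF
  have hpow : ∀ i (z : WithOne R),
      (e : WithOne R) * ((e * f) ^ i * (s * z)) = (e * f) ^ i * (s * z) := by
    rintro (_ | i) z
    · rw [pow_zero, one_mul, hESS]
    · rw [pow_succ', mul_assoc, mul_assoc, hEE]
  have hno' : ∀ i j, i + j ≠ 0 → (s : WithOne R) ≠ (e * f) ^ i * (s * (e * f) ^ j) := by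
    intro i j hij h
    rw [← mul_assoc, ← WithOne.coe_mul e f] at h
    rcases i with _ | i
    · obtain ⟨j, rfl⟩ : ∃ k, j = k + 1 := ⟨j - 1, by omega⟩
      exact hcon (Or.inl (mul_omegaPow_eq (m := j) (by simpa using h.symm)))
    · obtain ⟨n, hn⟩ := exists_eq_pow_mul h
      refine hcon (Or.inr (omegaPow_mul_eq (m := (i + 1) * n + i) ?_))
      rw [← pow_mul] at hn
      exact hn.symm
  have hgpow : ∀ n, (g : WithOne S) * t ^ (n + 1) = t ^ (n + 1) := by
    intro n
    rw [pow_succ', ← mul_assoc, hGT]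
  refine hY (YWord.mem_Y (P := S × R) (e := (g, e)) (f := (g, f)) (s := (t, s))
    (by simp [he.eq, hg.eq]) (by simp [hf.eq, hg.eq]) (by simp [hes, hgt]) (by simp [hsf, htg])
    (V.mem_prod hS hR) fun hw => ?_)
  have key := YWord.zero_induction (C := fun p : S × R =>
      (p.1 = g ∧ ((∃ n, (p.2 : WithOne R) * f = (e * f) ^ (n + 1)) ∨
        ∃ n, (p.2 : WithOne R) * f = f * (e * f) ^ (n + 1))) ∨
      (p.1 = t ∧ ((∃ i j, i + j ≠ 0 ∧ (p.2 : WithOne R) * f = (e * f) ^ i * (s * (e * f) ^ j)) ∨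
        ∃ i j, (p.2 : WithOne R) * f = f * ((e * f) ^ i * (s * (e * f) ^ j)))) ∨
      ∃ n, (p.1 : WithOne S) = t ^ (n + 2))
    (by simp [he.eq, hg.eq]) (by simp [hf.eq, hg.eq]) (by simp [hes, hgt]) (by simp [hsf, htg])
    (Or.inl ⟨by simp [hg.eq], Or.inl ⟨0, by simp [mul_assoc, hF]⟩⟩)
    (Or.inr (Or.inl ⟨by simp [htg], Or.inl ⟨0, 1, by simp, by simp [mul_assoc]⟩⟩))
    (Or.inr (Or.inr ⟨0, by simp [pow_succ]⟩))
    (Or.inl ⟨by simp [hg.eq], Or.inr ⟨0, by simp [mul_assoc]⟩⟩)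
    (Or.inr (Or.inl ⟨by simp [hgt], Or.inr ⟨0, 0, by simp [mul_assoc, hSF]⟩⟩))
    (by
      rintro ⟨p, q⟩ (⟨rfl, ⟨n, hn⟩ | ⟨n, hn⟩⟩ | ⟨rfl, ⟨i, j, hij, hn⟩ | ⟨i, j, hn⟩⟩ | ⟨n, hn⟩)
      · refine Or.inl ⟨hg.eq, Or.inl ⟨n, ?_⟩⟩
        simp only [Prod.mk_mul_mk, WithOne.coe_mul] at hn ⊢
        rw [mul_assoc, hn, pow_succ', mul_assoc, hEE]
      · refine Or.inl ⟨hg.eq, Or.inl ⟨n + 1, ?_⟩⟩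
        simp only [Prod.mk_mul_mk, WithOne.coe_mul] at hn ⊢
        rw [mul_assoc, hn, pow_succ' _ (n + 1), mul_assoc]
      · refine Or.inr (Or.inl ⟨hgt, Or.inl ⟨i, j, hij, ?_⟩⟩)
        simp only [Prod.mk_mul_mk, WithOne.coe_mul] at hn ⊢
        rw [mul_assoc, hn, hpow]
      · refine Or.inr (Or.inl ⟨hgt, Or.inl ⟨i + 1, j, by omega, ?_⟩⟩)
        simp only [Prod.mk_mul_mk, WithOne.coe_mul] at hn ⊢
        rw [mul_assoc, hn, pow_succ' _ i, mul_assoc, mul_assoc]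
      · refine Or.inr (Or.inr ⟨n, ?_⟩)
        simp only [Prod.mk_mul_mk, WithOne.coe_mul] at hn ⊢
        rw [hn, hgpow])
    (by
      rintro ⟨p, q⟩ (⟨rfl, ⟨n, hn⟩ | ⟨n, hn⟩⟩ | ⟨rfl, -⟩ | ⟨n, hn⟩)
      · refine Or.inr (Or.inl ⟨htg, Or.inl ⟨0, n + 1, by omega, ?_⟩⟩)
        simp only [Prod.mk_mul_mk, WithOne.coe_mul] at hn ⊢
        rw [mul_assoc, hn, pow_zero, one_mul]
      · refine Or.inr (Or.inl ⟨htg, Or.inl ⟨0, n + 1, by omega, ?_⟩⟩)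
        simp only [Prod.mk_mul_mk, WithOne.coe_mul] at hn ⊢
        rw [mul_assoc, hn, hSFF, pow_zero, one_mul]
      · exact Or.inr (Or.inr ⟨0, by simp [pow_succ]⟩)
      · refine Or.inr (Or.inr ⟨n + 1, ?_⟩)
        simp only [Prod.mk_mul_mk, WithOne.coe_mul] at hn ⊢
        rw [hn, ← pow_succ'])
    (by
      rintro ⟨p, q⟩ (⟨rfl, ⟨n, hn⟩ | ⟨n, hn⟩⟩ | ⟨rfl, ⟨i, j, hij, hn⟩ | ⟨i, j, hn⟩⟩ | ⟨n, hn⟩)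
      · refine Or.inl ⟨hg.eq, Or.inr ⟨n, ?_⟩⟩
        simp only [Prod.mk_mul_mk, WithOne.coe_mul] at hn ⊢
        rw [mul_assoc, hn]
      · refine Or.inl ⟨hg.eq, Or.inr ⟨n, ?_⟩⟩
        simp only [Prod.mk_mul_mk, WithOne.coe_mul] at hn ⊢
        rw [mul_assoc, hn, hFF]
      · refine Or.inr (Or.inl ⟨hgt, Or.inr ⟨i, j, ?_⟩⟩)
        simp only [Prod.mk_mul_mk, WithOne.coe_mul] at hn ⊢
        rw [mul_assoc, hn]
      · refine Or.inr (Or.inl ⟨hgt, Or.inr ⟨i, j, ?_⟩⟩)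
        simp only [Prod.mk_mul_mk, WithOne.coe_mul] at hn ⊢
        rw [mul_assoc, hn, hFF]
      · refine Or.inr (Or.inr ⟨n, ?_⟩)
        simp only [Prod.mk_mul_mk, WithOne.coe_mul] at hn ⊢
        rw [hn, hgpow])
    hw
  rcases key with ⟨h, -⟩ | ⟨-, ⟨i, j, hij, hn⟩ | ⟨i, j, hn⟩⟩ | ⟨n, hn⟩
  · obtain rfl : t = g := h
    exact ht (by rw [omegaPow_of_idempotent hg, hg.eq])
  · exact hno' i j hij (by rw [← hn, hSF])
  · refine hno' (i + 1) j (by omega) ?_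
    rw [pow_succ', mul_assoc, mul_assoc, ← hn, hSF, hES]
  · exact hno n hn.symm

-- If all local monoids `gSg` are unions of groups, the first pseudoidentity holds. Otherwise one
-- non-group local element serves as a counter for every member of `V`.
open Pseudovariety in
theorem le_of_not_mem_Y : V ≤ V₁ ∨ V ≤ V₂ ∨ V ≤ V₃ := by
  by_cases hloc : ∀ (S : Type) [Semigroup S] [Finite S] [Nonempty S], V.Mem S →
      ∀ g x : S, IsIdempotentElem g → omegaPow (g * x * g) * (g * x * g) = g * x * g
  · left
    intro S _ _ _ hS e x f he hf
    exact omegaPow_mul_self_of_local hY hS (hloc S hS) he hf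
      (by rw [← mul_assoc, ← mul_assoc, he.eq]) (by rw [mul_assoc, hf.eq])
  · right
    push Not at hloc
    obtain ⟨S, _, _, _, hS, g, t, hg, ht⟩ := hloc
    by_contra hcon
    rw [not_or] at hcon
    obtain ⟨h₂, h₃⟩ := hcon
    simp only [LE.le, V₂, V₃, ofPseudoidentity, not_forall] at h₂ h₃
    obtain ⟨A, _, _, _, hA, e, x, f, he, hf, hne⟩ := h₂
    obtain ⟨B, _, _, _, hB, e', x', f', he', hf', hne'⟩ := h₃
    -- Failures of the second and third pseudoidentities are combined in `A × B`, where one element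
    -- violates both.
    rcases mul_omegaPow_or_omegaPow_mul hY hS (V.mem_prod hA hB) hg
      (t := g * t * g) (by rw [← mul_assoc, ← mul_assoc, hg.eq]) (by rw [mul_assoc, hg.eq]) ht
      (e := (e, e')) (f := (f, f')) (s := (e * x * f, e' * x' * f'))
      (by simp [IsIdempotentElem, he.eq, he'.eq]) (by simp [IsIdempotentElem, hf.eq, hf'.eq])
      (by simp only [Prod.mk_mul_mk, ← mul_assoc, he.eq, he'.eq])
      (by simp only [Prod.mk_mul_mk, mul_assoc, hf.eq, hf'.eq]) with h | h
    · have := congrArg (MulHom.fst A B) h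
      rw [map_mul, map_omegaPow] at this
      exact hne this
    · have := congrArg (MulHom.snd A B) h
      rw [map_mul, map_omegaPow] at this
      exact hne' this

end Exclusion

end FinSemigroup

/-! ### The main theorem -/

open FinSemigroup Pseudovariety in
theorem theoremt :
    (∀ V : Pseudovariety,
      -- exactly one of the two alternatives holds
      Xor (V.FSaturated ∧ V.FEpimorphicallyClosed ∧ (V ≤ V₁ ∨ V ≤ V₂ ∨ V ≤ V₃))
        (¬ V.FSaturated ∧
          ∀ W : Pseudovariety, (W.FEpimorphicallyClosed ∧ V ≤ W) ↔ W = allFinite) ∧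
      -- the second alternative holds exactly when `Y` belongs to `V`
      ((¬ V.FSaturated ∧
          ∀ W : Pseudovariety, (W.FEpimorphicallyClosed ∧ V ≤ W) ↔ W = allFinite) ↔ V.Mem Y) ∧
      -- the case of proper pseudovarieties
      (V ≠ allFinite → (V.FEpimorphicallyClosed ↔ V.FSaturated))) ∧
    -- a single algorithm decides F-saturation of `V` from any program deciding membership in `V`
    (∃ F : Nat.Partrec.Code →. Bool, Partrec F ∧
      ∀ (V : Pseudovariety) (c : Nat.Partrec.Code), DecidesMembership c V →
        (V.FSaturated → true ∈ F c) ∧ (¬ V.FSaturated → false ∈ F c)) := by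
  have hsat : ∀ V : Pseudovariety, V.FSaturated ↔ ¬ V.Mem Y := fun V =>
    ⟨fun h hY => not_fSaturated_of_mem_Y hY h, fun hY => fSaturated_of_le (le_of_not_mem_Y hY)⟩
  refine ⟨fun V => ?_, rejectsY, partrec_rejectsY, fun V c hc => ?_⟩
  · by_cases hY : V.Mem Y
    · have hns := not_fSaturated_of_mem_Y hY
      have hall := allFinite_of_mem_Y hY
      refine ⟨Or.inr ⟨⟨hns, hall⟩, fun h => hns h.1⟩, ⟨fun _ => hY, fun _ => ⟨hns, hall⟩⟩,
        fun hV => ⟨fun h => ?_, fun h => absurd h hns⟩⟩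
      exact absurd ((hall V).1 ⟨h, fun _ _ _ _ hS => hS⟩) hV
    · have hs := (hsat V).2 hY
      exact ⟨Or.inl ⟨⟨hs, hs.fEpimorphicallyClosed, le_of_not_mem_Y hY⟩, fun h => h.1 hs⟩,
        ⟨fun h => absurd hs h.1, fun h => absurd h hY⟩,
        fun _ => ⟨fun _ => hs, fun h => h.fEpimorphicallyClosed⟩⟩
  · obtain ⟨h₁, h₂⟩ := rejectsY_spec hc
    rw [hsat]
    exact ⟨h₁, fun h => h₂ (not_not.1 h)⟩
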